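/- Consider the problem $$\min_{x,z}\ F(x)+\phi(z)\quad\text{s.t.}\quad A(x)+Qz=0,\qquad F(x)=f(x)+\sum_{i=1}^n I_i(x_i),$$ where $x=(x_1,\dots,x_n)\in\mathbb R^{n_x}$ has blocks $x_i\in\mathbb R^{n_i}$, $z\in\mathbb R^{n_z}$, $I_i$ is the indicator function ($0$ on $X_i$, $+\infty$ outside) of a polyhedral set $X_i=\{x_i: B_ix_i\le b_i\}$, $Q\in\mathbb R^{n_c\times n_z}$ has full row rank, and $A:\mathbb R^{n_x}\to\mathbb R^{n_c}$, $(A(x))_i=\tfrac12x^TC_ix+d_i^Tx+e_i$, is affine in each block $x_j$ when the other blocks are fixed. Let $f$ be $C^2$ and $\mu_f$-strongly convex with minimizer $x_f^\star$, and let $\phi$ be $C^2$, $\mu_\phi$-strongly convex with minimizer $z_\phi^\star$, and $L_\phi$-smooth, i.e. $\nabla\phi$ is $L_\phi$-Lipschitz ($\mu_f,\mu_\phi,L_\phi>0$). Let $$L(x,z,w)=F(x)+\phi(z)+\langle w,A(x)+Qz\rangle+\tfrac\rho2\|A(x)+Qz\|^2,$$ $$\rho>0,\qquad \rho\ge\max\Big\{\tfrac{4L_\phi^2}{\mu_\phi\lambda_{\min}^+(Q^TQ)},\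 \tfrac{4L_\phi^2}{\mu_\phi\sqrt{\lambda_{\min}^+(QQ^T)}}\Big\},$$ where $\lambda_{\min}^+$ is the smallest positive eigenvalue. Let $(x^k,z^k,w^k)_{k\ge0}$ be ADMM iterates: for $k\ge0$ and $i=1,\dots,n$, $$x_i^{k+1}\in\arg\min_{x_i}L(x^{k+1}_{1:i-1},x_i,x^k_{i+1:n},z^k,w^k),\quad z^{k+1}\in\arg\min_zL(x^{k+1},z,w^k),\quad w^{k+1}=w^k+\rho(A(x^{k+1})+Qz^{k+1}),$$ initialized so that $x^0_i\in X_i$ for all $i$, $A(x^0)+Qz^0=0$ and $Q^Tw^0=-\nabla\phi(z^0)$. Let $L_f>0$ be a Lipschitz constant of $\nabla f$ on the segment $[x_f^\star,x^0]$ (if $f$ is $L_f$-smooth, this $L_f$ may be taken). Write $\|C\|=\max_i\|C_i\|$ (spectral norm), $\|d\|=\max_i\|d_i\|$, $\|e\|=\max_i|e_i|$, and $$m_1=\frac{\mu_f\sqrt{\mu_\phi}}{\sqrt{n_c}\,L_\phi\big(\sqrt{L_f}(\|x_f^\star\|+\|x^0\|)+\sqrt{L_\phi}\,\|z_\phi^\star\|\big)},\quad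 m_2=\frac{\mu_f\sqrt{\mu_\phi}}{\sqrt{L_\phi^3n_c^2}\,(\|x^0\|\|d\|+\|e\|)},\quad m_3=\Big(\frac{\mu_f\sqrt{\mu_\phi}}{\sqrt{L_\phi^3n_c^2}\,\|x^0\|^2}\Big)^{1/2},$$ a quotient with denominator $0$ being $+\infty$. There is an absolute constant $\kappa>0$ such that, in this setting, whenever $$\|C\|\le\kappa\,\|(QQ^T)^{-1}Q\|^{-1}\min\Big\{m_1,\ m_2\,\lambda_{\min}(QQ^T)^{1/2},\ m_3\,\lambda_{\min}(QQ^T)^{1/4}\|(QQ^T)^{-1}Q\|^{1/2}\Big\},$$ the following holds. There are constants $c_2>1$ and $r>0$ such that the minimum of $L(\cdot,\cdot,w^k)$ over the closed Euclidean ball $\mathcal B(x^k,z^k;r)$ is attained and finite for every $k$, and $$L(x^k,z^k,w^k)-\min_{(x,z)\in\mathcal B(x^k,z^k;r)}L(x,z,w^k)\in\mathcal O(c_2^{-k}).$$ Furthermore, $(x^k,z^k)$ converges to a point $(x^\star,z^\star)$, which is feasible and is a local minimum of the problem. (No differentiability of $L$ at the limit is assumed.) -/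

import Mathlib

open Filter Topology

noncomputable section

/-- Vectors `x = (x₁, …, xₙ)` partitioned into `n` Euclidean blocks `xᵢ ∈ ℝ^{dᵢ}`,
with the Euclidean norm of `ℝ^{d₁ + ⋯ + dₙ}`. -/
abbrev BlockVec {n : ℕ} (d : Fin n → ℕ) : Type :=
  PiLp 2 (fun i : Fin n => EuclideanSpace ℝ (Fin (d i)))

/-- The flat coordinate vector of `x`; coordinates are indexed by pairs
(block, position in the block). -/
def BlockVec.flat {n : ℕ} {d : Fin n → ℕ} (x : BlockVec d) : (Σ i : Fin n, Fin (d i)) → ℝ :=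
  fun s => x s.1 s.2

/-- The data of the problem
`min f(x) + ∑ᵢ I_{Xᵢ}(xᵢ) + φ(z)` subject to `A(x) + Q z = 0`, where
`(A(x))ᵢ = xᵀ Cᵢ x / 2 + linᵢᵀ x + constᵢ`. No property of the data is part of the structure. -/
structure QuadConstrainedProblem {n : ℕ} (d : Fin n → ℕ) (nc nz : ℕ) where
  /-- the finite part of the objective in `x` -/
  f : BlockVec d → ℝ
  /-- the constraint sets of the blocks -/
  X : (i : Fin n) → Set (EuclideanSpace ℝ (Fin (d i)))
  /-- the objective in `z` -/
  φ : EuclideanSpace ℝ (Fin nz) → ℝ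
  /-- the matrices of the quadratic terms -/
  C : Fin nc → Matrix (Σ i : Fin n, Fin (d i)) (Σ i : Fin n, Fin (d i)) ℝ
  /-- the vectors of the linear terms -/
  lin : Fin nc → BlockVec d
  /-- the constant terms -/
  const : Fin nc → ℝ
  /-- the matrix acting on `z` -/
  Q : Matrix (Fin nc) (Fin nz) ℝ

/-- A polyhedral set: `{x | A x ≤ b}` for some matrix `A` and some vector `b`. -/
def IsPolyhedralSet {p : ℕ} (S : Set (EuclideanSpace ℝ (Fin p))) : Prop :=
  ∃ (m : ℕ) (A : Matrix (Fin m) (Fin p) ℝ) (b : Fin m → ℝ),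
    S = {x | ∀ j, A.mulVec (WithLp.ofLp x) j ≤ b j}

/-- The smallest eigenvalue of a symmetric real matrix. -/
def lambdaMin {p : ℕ} (M : Matrix (Fin p) (Fin p) ℝ) : ℝ :=
  sInf (spectrum ℝ M)

/-- The smallest positive eigenvalue of a symmetric real matrix. -/
def lambdaMinPos {p : ℕ} (M : Matrix (Fin p) (Fin p) ℝ) : ℝ :=
  sInf {t : ℝ | t ∈ spectrum ℝ M ∧ 0 < t}

open scoped Matrix.Norms.L2Operator in
/-- The spectral norm of a real matrix (the operator norm for the Euclidean norms). -/
def spectralNorm₂ {ι κ : Type} [Fintype ι] [Fintype κ] [DecidableEq κ]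
    (M : Matrix ι κ ℝ) : ℝ :=
  ‖M‖

/-- The function `g` is `L`-smooth: its gradient is `L`-Lipschitz on the whole space. -/
def IsLSmooth {p : ℕ} (L : ℝ) (g : EuclideanSpace ℝ (Fin p) → ℝ) : Prop :=
  ∀ u v, ‖gradient g u - gradient g v‖ ≤ L * ‖u - v‖

namespace QuadConstrainedProblem

variable {n : ℕ} {d : Fin n → ℕ} {nc nz : ℕ}

/-- The quadratic operator `A`. -/
def A (P : QuadConstrainedProblem d nc nz) (x : BlockVec d) : EuclideanSpace ℝ (Fin nc) :=
  WithLp.toLp 2 fun i =>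
    dotProduct x.flat ((P.C i).mulVec x.flat) / 2 + inner ℝ (P.lin i) x + P.const i

/-- `A` is multi-affine: it is affine in each block when the other blocks are fixed. -/
def IsMultiAffine (P : QuadConstrainedProblem d nc nz) : Prop :=
  ∀ (j : Fin n) (x : BlockVec d),
    ∃ g : EuclideanSpace ℝ (Fin (d j)) →ᵃ[ℝ] EuclideanSpace ℝ (Fin nc),
      ∀ y, P.A (WithLp.toLp 2 (Function.update (WithLp.ofLp x) j y)) = g y

/-- The left-hand side `A(x) + Q z` of the constraint. -/
def residual (P : QuadConstrainedProblem d nc nz) (x : BlockVec d)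
    (z : EuclideanSpace ℝ (Fin nz)) : EuclideanSpace ℝ (Fin nc) :=
  P.A x + WithLp.toLp 2 (P.Q.mulVec (WithLp.ofLp z))

open Classical in
/-- The indicator function of the `i`-th constraint set, with values `0` and `∞`. -/
def indic (P : QuadConstrainedProblem d nc nz) (i : Fin n)
    (y : EuclideanSpace ℝ (Fin (d i))) : EReal :=
  if y ∈ P.X i then 0 else ⊤

/-- `F(x) = f(x) + ∑ᵢ Iᵢ(xᵢ)`. -/
def F (P : QuadConstrainedProblem d nc nz) (x : BlockVec d) : EReal :=
  (P.f x : EReal) + ∑ i, P.indic i (x i)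

/-- The augmented Lagrangian
`L(x,z,w) = F(x) + φ(z) + ⟨w, A(x) + Q z⟩ + (ρ/2) ‖A(x) + Q z‖²`. -/
def lagrangian (P : QuadConstrainedProblem d nc nz) (ρ : ℝ) (x : BlockVec d)
    (z : EuclideanSpace ℝ (Fin nz)) (w : EuclideanSpace ℝ (Fin nc)) : EReal :=
  P.F x +
    ((P.φ z + inner ℝ w (P.residual x z) + ρ / 2 * ‖P.residual x z‖ ^ 2 : ℝ) : EReal)

/-- The point `(x'₁, …, x'ᵢ₋₁, y, xᵢ₊₁, …, xₙ)` at which the `i`-th block is updated, when `x` is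
the old and `x'` is the new iterate. -/
def sweep (x x' : BlockVec d) (i : Fin n) (y : EuclideanSpace ℝ (Fin (d i))) : BlockVec d :=
  WithLp.toLp 2 (Function.update (fun j => if j < i then x' j else x j) i y)

/-- `(x k, z k, w k)`, `k = 0, 1, 2, …`, are iterates of ADMM with penalty parameter `ρ`. -/
structure IsADMM (P : QuadConstrainedProblem d nc nz) (ρ : ℝ) (x : ℕ → BlockVec d)
    (z : ℕ → EuclideanSpace ℝ (Fin nz)) (w : ℕ → EuclideanSpace ℝ (Fin nc)) : Prop where
  x_step : ∀ (k : ℕ) (i : Fin n),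
    IsMinOn (fun y => P.lagrangian ρ (sweep (x k) (x (k + 1)) i y) (z k) (w k)) Set.univ
      (x (k + 1) i)
  z_step : ∀ k : ℕ, IsMinOn (fun y => P.lagrangian ρ (x (k + 1)) y (w k)) Set.univ (z (k + 1))
  w_step : ∀ k : ℕ, w (k + 1) = w k + ρ • P.residual (x (k + 1)) (z (k + 1))

/-- `(xs, zs)` is feasible and is a local minimum of `F(x) + φ(z)` on `{A(x) + Q z = 0}`. -/
def IsLocalMinimum (P : QuadConstrainedProblem d nc nz) (xs : BlockVec d)
    (zs : EuclideanSpace ℝ (Fin nz)) : Prop :=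
  (∀ i, xs i ∈ P.X i) ∧ P.residual xs zs = 0 ∧
    IsLocalMinOn (fun p : BlockVec d × EuclideanSpace ℝ (Fin nz) => P.F p.1 + (P.φ p.2 : EReal))
      {p | P.residual p.1 p.2 = 0} (xs, zs)

/-- `‖C‖ = maxᵢ ‖Cᵢ‖` -/
def normC (P : QuadConstrainedProblem d nc nz) : ℝ := ⨆ i, spectralNorm₂ (P.C i)

/-- `maxᵢ ‖linᵢ‖` -/
def normLin (P : QuadConstrainedProblem d nc nz) : ℝ := ⨆ i, ‖P.lin i‖

/-- `maxᵢ |constᵢ|` -/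
def normConst (P : QuadConstrainedProblem d nc nz) : ℝ := ⨆ i, |P.const i|

/-- `‖(Q Qᵀ)⁻¹ Q‖` -/
def normPinv (P : QuadConstrainedProblem d nc nz) : ℝ :=
  spectralNorm₂ ((P.Q * P.Q.transpose)⁻¹ * P.Q)

/-- `λ_min(Q Qᵀ)` -/
def lamQ (P : QuadConstrainedProblem d nc nz) : ℝ := lambdaMin (P.Q * P.Q.transpose)

/-- `m₁ = μ_f √μ_φ / (√n_c L_φ (√L_f (‖x_f‖ + ‖x⁰‖) + √L_φ ‖z_φ‖))`, which is `∞` if the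
denominator vanishes. -/
def m₁ (_P : QuadConstrainedProblem d nc nz) (Lf μf Lφ μφ : ℝ) (x0 xf : BlockVec d)
    (zφ : EuclideanSpace ℝ (Fin nz)) : ENNReal :=
  ENNReal.ofReal (μf * √μφ) /
    ENNReal.ofReal (√nc * Lφ * (√Lf * (‖xf‖ + ‖x0‖) + √Lφ * ‖zφ‖))

/-- `m₂ = μ_f √μ_φ / (√(L_φ³ n_c²) (‖x⁰‖ ‖lin‖ + ‖const‖))`, which is `∞` if the
denominator vanishes. -/
def m₂ (P : QuadConstrainedProblem d nc nz) (μf Lφ μφ : ℝ) (x0 : BlockVec d) : ENNReal :=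
  ENNReal.ofReal (μf * √μφ) /
    ENNReal.ofReal (√(Lφ ^ 3 * (nc : ℝ) ^ 2) * (‖x0‖ * P.normLin + P.normConst))

/-- `m₃ = (μ_f √μ_φ / (√(L_φ³ n_c²) ‖x⁰‖²))^{1/2}`, which is `∞` if the
denominator vanishes. -/
def m₃ (_P : QuadConstrainedProblem d nc nz) (μf Lφ μφ : ℝ) (x0 : BlockVec d) : ENNReal :=
  (ENNReal.ofReal (μf * √μφ) /
    ENNReal.ofReal (√(Lφ ^ 3 * (nc : ℝ) ^ 2) * ‖x0‖ ^ 2)) ^ (1 / 2 : ℝ)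

/-- The smallness condition on the quadratic part, with `κ` the constant of the `𝒪`:
`‖C‖ ≤ κ ‖(QQᵀ)⁻¹Q‖⁻¹ min {m₁, m₂ λ_min(QQᵀ)^{1/2}, m₃ λ_min(QQᵀ)^{1/4} ‖(QQᵀ)⁻¹Q‖^{1/2}}`. -/
def QCondition (P : QuadConstrainedProblem d nc nz) (κ Lf μf Lφ μφ : ℝ) (x0 xf : BlockVec d)
    (zφ : EuclideanSpace ℝ (Fin nz)) : Prop :=
  ENNReal.ofReal P.normC ≤
    ENNReal.ofReal κ * ((ENNReal.ofReal P.normPinv)⁻¹ *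
      min (P.m₁ Lf μf Lφ μφ x0 xf zφ)
        (min (P.m₂ μf Lφ μφ x0 * ENNReal.ofReal (P.lamQ ^ (1 / 2 : ℝ)))
          (P.m₃ μf Lφ μφ x0 * ENNReal.ofReal (P.lamQ ^ (1 / 4 : ℝ)) *
            ENNReal.ofReal (P.normPinv ^ (1 / 2 : ℝ)))))

end QuadConstrainedProblem

/-- The closed Euclidean ball `B(x, z; r)` in the space of pairs `(x, z)`. -/
def pairBall {n : ℕ} {d : Fin n → ℕ} {nz : ℕ} (x : BlockVec d) (z : EuclideanSpace ℝ (Fin nz))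
    (r : ℝ) : Set (BlockVec d × EuclideanSpace ℝ (Fin nz)) :=
  {p | ‖p.1 - x‖ ^ 2 + ‖p.2 - z‖ ^ 2 ≤ r ^ 2}

end

/-! Where every block lies in its constraint set, the augmented Lagrangian is a C² function,
`smoothLag`. Write R = A(x) + Qz. The only nonconvex contribution to its expansion at a point is the
curvature of A paired with w + ρR (`smoothLag_add_ge`). Multi-affinity kills this curvature along a
single block, so each block update, like the z-update, gains a strong-convexity decrease.
Stationarity in z gives the invariant Qᵀwᵏ = -∇φ(zᵏ) (`dual_eq`), so multiplier steps are controlled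
by z-steps. The lower bound on ρ then limits the rise caused by the dual update to half of the
z-gain (`descent`), and it bounds L from below (`smoothLag_ge`). Hence the iterates stay bounded in
terms of the initial data.

The invariant also turns these bounds into one on ‖wᵏ‖, and smallness of ‖C‖ gives √n_c ‖wᵏ‖ ‖C‖ ≤
μ_f/6 (`small_dual`): the curvature is now dominated by the strong convexity of f. Together with an
approximate variational inequality (`exists_fderiv_ge`) this yields, for all feasible blocks y and
all v, Lᵏ⁺¹ + (quadratic distance to (y, v)) ≤ L(y, v, wᵏ⁺¹) + K (Lᵏ - Lᵏ⁺¹)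
(`exists_smoothLag_ge`).

Everything follows by testing this inequality. At a feasible cluster point, where L does not depend
on w, it gives linear decrease of L and convergence of the whole sequence. At minimizers over balls
it bounds the gap. At arbitrary feasible points it shows that the limit is even a global minimum. -/

/-! ### Spectral facts about Q Qᵀ and the pseudoinverse -/

namespace Matrix

/-- A real matrix as a continuous linear map between Euclidean spaces. -/
noncomputable def mulE {ι κ : Type} [Fintype ι] [Fintype κ] [DecidableEq κ] (M : Matrix ι κ ℝ) :
    EuclideanSpace ℝ κ →L[ℝ] EuclideanSpace ℝ ι :=
  LinearMap.toContinuousLinearMap (Matrix.toEuclideanLin M)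

section
set_option linter.unusedSectionVars false
variable {ι κ μ : Type} [Fintype ι] [Fintype κ] [DecidableEq κ] [Fintype μ] [DecidableEq μ]

theorem mulE_apply (M : Matrix ι κ ℝ) (v : EuclideanSpace ℝ κ) :
    M.mulE v = WithLp.toLp 2 (M.mulVec (WithLp.ofLp v)) := rfl

theorem mulE_mul (M : Matrix ι κ ℝ) (N : Matrix κ μ ℝ) (v : EuclideanSpace ℝ μ) :
    (M * N).mulE v = M.mulE (N.mulE v) := by
  simp [mulE_apply, Matrix.mulVec_mulVec]

theorem one_mulE (v : EuclideanSpace ℝ κ) : (1 : Matrix κ κ ℝ).mulE v = v := by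
  simp [mulE_apply]

theorem norm_mulE (M : Matrix ι κ ℝ) : ‖M.mulE‖ = spectralNorm₂ M := rfl

theorem spectralNorm₂_nonneg (M : Matrix ι κ ℝ) : 0 ≤ spectralNorm₂ M :=
  norm_nonneg M.mulE

theorem norm_mulE_apply_le (M : Matrix ι κ ℝ) (v : EuclideanSpace ℝ κ) :
    ‖M.mulE v‖ ≤ spectralNorm₂ M * ‖v‖ :=
  M.mulE.le_opNorm v

theorem spectralNorm₂_transpose [DecidableEq ι] (M : Matrix ι κ ℝ) :
    spectralNorm₂ M.transpose = spectralNorm₂ M := by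
  have h := Matrix.l2_opNorm_conjTranspose M
  rw [Matrix.conjTranspose_eq_transpose_of_trivial] at h
  exact h

theorem inner_mulE [DecidableEq ι] (M : Matrix ι κ ℝ) (v : EuclideanSpace ℝ κ)
    (u : EuclideanSpace ℝ ι) :
    inner ℝ (M.mulE v) u = inner ℝ v (M.transpose.mulE u) := by
  simp only [mulE_apply, EuclideanSpace.inner_eq_star_dotProduct, star_trivial]
  rw [Matrix.mulVec_transpose, Matrix.dotProduct_mulVec]

theorem norm_sq_mulE_transpose [DecidableEq ι] (M : Matrix ι κ ℝ) (u : EuclideanSpace ℝ ι) :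
    ‖M.transpose.mulE u‖ ^ 2 = inner ℝ ((M * M.transpose).mulE u) u := by
  rw [mulE_mul, inner_mulE, real_inner_self_eq_norm_sq]

theorem isHermitian_mul_transpose_self' (M : Matrix ι κ ℝ) : (M * M.transpose).IsHermitian := by
  simpa [Matrix.conjTranspose_eq_transpose_of_trivial] using M.isHermitian_mul_conjTranspose_self

theorem mem_spectrum_iff_det {M : Matrix κ κ ℝ} {t : ℝ} (ht : t ≠ 0) :
    t ∈ spectrum ℝ M ↔ (1 - t⁻¹ • M).det = 0 := by
  have h : algebraMap ℝ (Matrix κ κ ℝ) t - M = t • (1 - t⁻¹ • M) := by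
    rw [smul_sub, smul_smul, mul_inv_cancel₀ ht, one_smul, Algebra.algebraMap_eq_smul_one]
  rw [spectrum.mem_iff, h, Matrix.isUnit_iff_isUnit_det, Matrix.det_smul]
  simp [ht]

/-- Sylvester's identity det(1 - MN) = det(1 - NM), after rescaling by t⁻¹. -/
theorem mem_spectrum_mul_comm [DecidableEq ι] {M : Matrix ι κ ℝ} {N : Matrix κ ι ℝ} {t : ℝ}
    (ht : t ≠ 0) :
    t ∈ spectrum ℝ (M * N) ↔ t ∈ spectrum ℝ (N * M) := by
  rw [mem_spectrum_iff_det ht, mem_spectrum_iff_det ht, ← Matrix.smul_mul,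
    Matrix.det_one_sub_mul_comm, Matrix.mul_smul]
end

variable {p q : ℕ}

theorem lambdaMin_mul_norm_sq_le {M : Matrix (Fin p) (Fin p) ℝ} (hM : M.IsHermitian)
    (v : EuclideanSpace ℝ (Fin p)) : lambdaMin M * ‖v‖ ^ 2 ≤ inner ℝ (M.mulE v) v := by
  have hb : BddBelow (spectrum ℝ M) := M.finite_real_spectrum.bddBelow
  have hH : (M - algebraMap ℝ _ (lambdaMin M)).IsHermitian := by
    refine hM.sub ?_
    rw [Algebra.algebraMap_eq_smul_one]
    simp [Matrix.IsHermitian]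
  have hP : (M - algebraMap ℝ _ (lambdaMin M)).PosSemidef := by
    refine (hH.posSemidef_iff_eigenvalues_nonneg).2 fun i => ?_
    have h := hH.eigenvalues_mem_spectrum_real i
    rw [← spectrum.sub_singleton_eq] at h
    obtain ⟨s, hs, c, hc, h⟩ := h
    have := csInf_le hb hs
    simp only [Set.mem_singleton_iff] at hc
    simp only [Pi.zero_apply]
    rw [← h, hc]
    simpa [lambdaMin] using this
  have := hP.dotProduct_mulVec_nonneg (WithLp.ofLp v)
  rw [Matrix.sub_mulVec, dotProduct_sub, Algebra.algebraMap_eq_smul_one, Matrix.smul_mulVec,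
    Matrix.one_mulVec, dotProduct_smul] at this
  have h2 : ‖v‖ ^ 2 = dotProduct (WithLp.ofLp v) (WithLp.ofLp v) := by
    rw [← real_inner_self_eq_norm_sq, EuclideanSpace.inner_eq_star_dotProduct, star_trivial]
  rw [h2, mulE_apply, EuclideanSpace.inner_eq_star_dotProduct]
  simp only [star_trivial, smul_eq_mul] at this ⊢
  linarith

theorem posDef_mul_transpose_of_rank_eq {Q : Matrix (Fin p) (Fin q) ℝ} (hQ : Q.rank = p) :
    (Q * Q.transpose).PosDef := by
  have hr : LinearIndependent ℝ Q.row := by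
    rw [linearIndependent_iff_card_eq_finrank_span]
    rw [Matrix.rank_eq_finrank_span_row] at hQ
    simpa [Set.finrank] using hQ.symm
  have := Matrix.PosDef.mul_conjTranspose_self Q (Matrix.vecMul_injective_iff.2 hr)
  simpa [Matrix.conjTranspose_eq_transpose_of_trivial] using this

theorem nonempty_spectrum_of_pos {M : Matrix (Fin p) (Fin p) ℝ} (hM : M.IsHermitian) (hp : 0 < p) :
    (spectrum ℝ M).Nonempty :=
  ⟨_, hM.eigenvalues_mem_spectrum_real ⟨0, hp⟩⟩

theorem pos_of_mem_spectrum {M : Matrix (Fin p) (Fin p) ℝ} (hM : M.PosDef) {t : ℝ}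
    (ht : t ∈ spectrum ℝ M) : 0 < t := by
  rw [hM.1.spectrum_real_eq_range_eigenvalues] at ht
  obtain ⟨i, rfl⟩ := ht
  exact hM.eigenvalues_pos i

theorem lambdaMin_pos {M : Matrix (Fin p) (Fin p) ℝ} (hM : M.PosDef) (hp : 0 < p) :
    0 < lambdaMin M :=
  pos_of_mem_spectrum hM
    ((nonempty_spectrum_of_pos hM.1 hp).csInf_mem M.finite_real_spectrum)

/-- QᵀQ and QQᵀ share their nonzero eigenvalues, and full row rank makes all those of QQᵀ positive.
This makes the condition on ρ a coercivity statement for Qᵀ. -/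
theorem lambdaMinPos_transpose_mul_self {Q : Matrix (Fin p) (Fin q) ℝ} (hQ : Q.rank = p) :
    lambdaMinPos (Q.transpose * Q) = lambdaMin (Q * Q.transpose) := by
  have hP := posDef_mul_transpose_of_rank_eq hQ
  have : {t : ℝ | t ∈ spectrum ℝ (Q.transpose * Q) ∧ 0 < t} = spectrum ℝ (Q * Q.transpose) := by
    ext t
    constructor
    · rintro ⟨h, h0⟩
      exact (mem_spectrum_mul_comm h0.ne').1 h
    · intro h
      have h0 := pos_of_mem_spectrum hP h
      exact ⟨(mem_spectrum_mul_comm h0.ne').1 h, h0⟩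
  rw [lambdaMinPos, this, lambdaMin]

theorem isUnit_mul_transpose_of_rank_eq {Q : Matrix (Fin p) (Fin q) ℝ} (hQ : Q.rank = p) :
    IsUnit (Q * Q.transpose).det :=
  (posDef_mul_transpose_of_rank_eq hQ).det_pos.ne'.isUnit

/-- `(Q Qᵀ)⁻¹ Q` is a left inverse of `Qᵀ`. -/
theorem pinv_mulE_transpose {Q : Matrix (Fin p) (Fin q) ℝ} (hQ : Q.rank = p)
    (u : EuclideanSpace ℝ (Fin p)) :
    ((Q * Q.transpose)⁻¹ * Q).mulE (Q.transpose.mulE u) = u := by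
  rw [← mulE_mul, Matrix.mul_assoc, Matrix.nonsing_inv_mul _ (isUnit_mul_transpose_of_rank_eq hQ),
    one_mulE]

/-- `((Q Qᵀ)⁻¹ Q)ᵀ` is a right inverse of `Q`. -/
theorem mulE_pinv_transpose {Q : Matrix (Fin p) (Fin q) ℝ} (hQ : Q.rank = p)
    (u : EuclideanSpace ℝ (Fin p)) :
    Q.mulE (((Q * Q.transpose)⁻¹ * Q).transpose.mulE u) = u := by
  rw [← mulE_mul, Matrix.transpose_mul, ← Matrix.mul_assoc, Matrix.transpose_nonsing_inv,
    Matrix.transpose_mul, Matrix.transpose_transpose,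
    Matrix.mul_nonsing_inv _ (isUnit_mul_transpose_of_rank_eq hQ), one_mulE]

theorem spectralNorm₂_pinv_pos {Q : Matrix (Fin p) (Fin q) ℝ} (hQ : Q.rank = p) (hp : 0 < p) :
    0 < spectralNorm₂ ((Q * Q.transpose)⁻¹ * Q) := by
  refine (spectralNorm₂_nonneg _).lt_of_ne' fun h => ?_
  have h1 := pinv_mulE_transpose hQ (EuclideanSpace.single ⟨0, hp⟩ 1)
  rw [← norm_mulE, norm_eq_zero] at h
  rw [h] at h1
  have := congrArg norm h1
  simp at this

theorem lambdaMin_mul_norm_sq_le_transpose (Q : Matrix (Fin p) (Fin q) ℝ)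
    (u : EuclideanSpace ℝ (Fin p)) :
    lambdaMin (Q * Q.transpose) * ‖u‖ ^ 2 ≤ ‖Q.transpose.mulE u‖ ^ 2 := by
  rw [norm_sq_mulE_transpose]
  exact lambdaMin_mul_norm_sq_le (isHermitian_mul_transpose_self' Q) u

/-- For u = (QQᵀ)⁻¹Qv one has QQᵀu = Qv, so ‖Qᵀu‖² = ⟨v, Qᵀu⟩ and ‖Qᵀu‖ ≤ ‖v‖, while λ_min ‖u‖² ≤
‖Qᵀu‖². The powers of λ_min in the smallness condition are absorbed through this bound. -/
theorem sqrt_lambdaMin_mul_spectralNorm₂_pinv_le {Q : Matrix (Fin p) (Fin q) ℝ}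
    (hQ : Q.rank = p) (hp : 0 < p) :
    √(lambdaMin (Q * Q.transpose)) * spectralNorm₂ ((Q * Q.transpose)⁻¹ * Q) ≤ 1 := by
  have hl := lambdaMin_pos (posDef_mul_transpose_of_rank_eq hQ) hp
  rw [← le_div_iff₀' (Real.sqrt_pos.2 hl), ← norm_mulE]
  refine ContinuousLinearMap.opNorm_le_bound _ (by positivity) fun v => ?_
  set u := ((Q * Q.transpose)⁻¹ * Q).mulE v with hu
  have h1 : (Q * Q.transpose).mulE u = Q.mulE v := by
    rw [hu, ← mulE_mul, ← Matrix.mul_assoc,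
      Matrix.mul_nonsing_inv _ (isUnit_mul_transpose_of_rank_eq hQ), Matrix.one_mul]
  have h2 : ‖Q.transpose.mulE u‖ ^ 2 ≤ ‖v‖ * ‖Q.transpose.mulE u‖ := by
    rw [norm_sq_mulE_transpose, h1, inner_mulE]
    exact real_inner_le_norm _ _
  have h3 : ‖Q.transpose.mulE u‖ ≤ ‖v‖ := by
    rcases (norm_nonneg (Q.transpose.mulE u)).eq_or_lt with h | h
    · rw [← h]; exact norm_nonneg v
    · nlinarith
  have h4 := lambdaMin_mul_norm_sq_le_transpose Q u
  have h5 : (√(lambdaMin (Q * Q.transpose)) * ‖u‖) ^ 2 ≤ ‖v‖ ^ 2 := by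
    rw [mul_pow, Real.sq_sqrt hl.le]
    exact h4.trans (pow_le_pow_left₀ (norm_nonneg _) h3 2)
  have h6 := (sq_le_sq₀ (by positivity) (norm_nonneg _)).1 h5
  rw [div_mul_eq_mul_div, one_mul, le_div_iff₀ (Real.sqrt_pos.2 hl), mul_comm]
  exact h6

end Matrix

/-! ### First-order consequences of minimality and strong convexity -/

theorem nonneg_of_hasDerivAt_of_min_left {g : ℝ → ℝ} {a : ℝ} (hg : HasDerivAt g a 0)
    (h : ∀ t ∈ Set.Icc (0 : ℝ) 1, g 0 ≤ g t) : 0 ≤ a := by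
  have hmin : IsLocalMinOn g (Set.Icc 0 1) 0 :=
    IsMinOn.localize (isMinOn_iff.2 h)
  have hc : (1 : ℝ) ∈ posTangentConeAt (Set.Icc (0 : ℝ) 1) 0 :=
    mem_posTangentConeAt_of_segment_subset (by rw [zero_add, segment_eq_Icc zero_le_one])
  simpa using hmin.hasFDerivWithinAt_nonneg hg.hasFDerivAt.hasFDerivWithinAt hc

section
variable {E : Type*} [NormedAddCommGroup E] [NormedSpace ℝ E]

theorem HasFDerivAt.hasDerivAt_line {F : Type*} [NormedAddCommGroup F] [NormedSpace ℝ F]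
    {g : E → F} {g' : E →L[ℝ] F} {x : E} (hg : HasFDerivAt g g' x)
    (v : E) : HasDerivAt (fun t : ℝ => g (x + t • v)) (g' v) 0 := by
  have h1 : HasDerivAt (fun t : ℝ => x + t • v) v 0 := by
    simpa using ((hasDerivAt_id (0 : ℝ)).smul_const v).const_add x
  have h2 : HasFDerivAt g g' (x + (0 : ℝ) • v) := by simpa using hg
  exact h2.comp_hasDerivAt (0 : ℝ) h1

theorem StrongConvexOn.add_fderiv_add_le {g : E → ℝ} {m : ℝ} {g' : E →L[ℝ] ℝ} {x : E}
    (hc : StrongConvexOn Set.univ m g) (hg : HasFDerivAt g g' x) (v : E) :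
    g x + g' v + m / 2 * ‖v‖ ^ 2 ≤ g (x + v) := by
  have h1 := hg.hasDerivAt_line v
  -- Strong convexity at parameter t says exactly that this function is minimal over [0, 1] at t =
  -- 0; the claim is that its derivative there is nonnegative.
  have h2 : HasDerivAt (fun t : ℝ => t * (g (x + v) - g x - m / 2 * ‖v‖ ^ 2)
      + t ^ 2 * (m / 2 * ‖v‖ ^ 2) - g (x + t • v))
      (g (x + v) - g x - m / 2 * ‖v‖ ^ 2 - g' v) 0 := by
    have a := (hasDerivAt_id (0 : ℝ)).mul_const (g (x + v) - g x - m / 2 * ‖v‖ ^ 2)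
    have b := ((hasDerivAt_id (0 : ℝ)).pow 2).mul_const (m / 2 * ‖v‖ ^ 2)
    simpa using! (a.add b).sub h1
  have := nonneg_of_hasDerivAt_of_min_left h2 fun t ht => by
    have := hc.2 (Set.mem_univ x) (Set.mem_univ (x + v)) (sub_nonneg.2 ht.2) ht.1 (by ring)
    have e : (1 - t) • x + t • (x + v) = x + t • v := by module
    rw [e] at this
    simp only [smul_eq_mul, sub_add_cancel_left, norm_neg] at this
    simp only [zero_smul, add_zero]
    nlinarith
  linarith

theorem StrongConvexOn.add_norm_sq_le_of_isMinOn {g : E → ℝ} {m : ℝ} {x : E}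
    (hc : StrongConvexOn Set.univ m g) (hg : DifferentiableAt ℝ g x) (hx : IsMinOn g Set.univ x)
    (y : E) : g x + m / 2 * ‖y - x‖ ^ 2 ≤ g y := by
  have h0 : fderiv ℝ g x = 0 := (hx.isLocalMin univ_mem).fderiv_eq_zero
  have := hc.add_fderiv_add_le hg.hasFDerivAt (y - x)
  simpa [h0] using this

end

section
variable {E : Type*} [NormedAddCommGroup E] [InnerProductSpace ℝ E] [CompleteSpace E]

theorem fderiv_apply_eq_inner_gradient {g : E → ℝ} (x v : E) :
    fderiv ℝ g x v = inner ℝ (gradient g x) v := by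
  rw [gradient, InnerProductSpace.toDual_symm_apply]

theorem IsMinOn.gradient_eq_zero {g : E → ℝ} {x : E} (hx : IsMinOn g Set.univ x) :
    gradient g x = 0 := by
  rw [gradient, (hx.isLocalMin univ_mem).fderiv_eq_zero, map_zero]

/-- Convexity at y gives g y - g x ≤ ⟨∇g y, y - x⟩, and ∇g x = 0. Only a gradient estimate between
the two points enters, so the lemma serves both L_f and L_φ. -/
theorem StrongConvexOn.sub_le_mul_norm_sq {g : E → ℝ} {m L : ℝ} {x y : E} (hm : 0 ≤ m)
    (hc : StrongConvexOn Set.univ m g) (hg : DifferentiableAt ℝ g y) (hx : IsMinOn g Set.univ x)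
    (hL : ‖gradient g y - gradient g x‖ ≤ L * ‖y - x‖) : g y - g x ≤ L * ‖y - x‖ ^ 2 := by
  have h1 := hc.add_fderiv_add_le hg.hasFDerivAt (x - y)
  rw [fderiv_apply_eq_inner_gradient, add_sub_cancel, ← neg_sub y x, inner_neg_right] at h1
  rw [hx.gradient_eq_zero, sub_zero] at hL
  have h2 := real_inner_le_norm (gradient g y) (y - x)
  have h3 : 0 ≤ m / 2 * ‖-(y - x)‖ ^ 2 := by positivity
  nlinarith [norm_nonneg (y - x)]

end

/-! ### Expansion and size of the quadratic operator -/

theorem EuclideanSpace.norm_le_sqrt_mul {m : ℕ} {v : EuclideanSpace ℝ (Fin m)} {c : ℝ} (hc : 0 ≤ c)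
    (h : ∀ i, |v i| ≤ c) : ‖v‖ ≤ √m * c := by
  rw [EuclideanSpace.norm_eq]
  refine Real.sqrt_le_iff.2 ⟨by positivity, ?_⟩
  rw [mul_pow, Real.sq_sqrt (Nat.cast_nonneg m)]
  calc _ ≤ ∑ _i : Fin m, c ^ 2 := Finset.sum_le_sum fun i _ => by
          rw [Real.norm_eq_abs]; exact pow_le_pow_left₀ (abs_nonneg _) (h i) 2
    _ = _ := by simp

namespace QuadConstrainedProblem

variable {n : ℕ} {d : Fin n → ℕ} {nc nz : ℕ}

/-- The vector with coordinates `hᵀ Cᵢ h`. -/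
noncomputable def quad (P : QuadConstrainedProblem d nc nz) (h : BlockVec d) :
    EuclideanSpace ℝ (Fin nc) :=
  WithLp.toLp 2 fun i => dotProduct h.flat ((P.C i).mulVec h.flat)

/-- The derivative of `A` at `x` in the direction `h`. -/
noncomputable def dA (P : QuadConstrainedProblem d nc nz) (x h : BlockVec d) :
    EuclideanSpace ℝ (Fin nc) :=
  WithLp.toLp 2 fun i =>
    (dotProduct x.flat ((P.C i).mulVec h.flat) + dotProduct h.flat ((P.C i).mulVec x.flat)) / 2
      + inner ℝ (P.lin i) h

theorem flat_add_smul (x h : BlockVec d) (t : ℝ) :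
    BlockVec.flat (x + t • h) = x.flat + t • h.flat := by
  ext s; simp [BlockVec.flat]

/-- Exact second-order expansion. The matrices Cᵢ need not be symmetric, hence the symmetrized
first-order term in `dA`. -/
theorem A_add_smul (P : QuadConstrainedProblem d nc nz) (x h : BlockVec d) (t : ℝ) :
    P.A (x + t • h) = P.A x + t • P.dA x h + (t ^ 2 / 2) • P.quad h := by
  ext i
  simp only [A, dA, quad, flat_add_smul, Matrix.mulVec_add, Matrix.mulVec_smul, dotProduct_add,
    add_dotProduct, smul_dotProduct, dotProduct_smul, inner_add_right, inner_smul_right,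
    PiLp.add_apply, PiLp.smul_apply, smul_eq_mul]
  ring

theorem contDiff_flat (s : Σ i : Fin n, Fin (d i)) : ContDiff ℝ 2 fun x : BlockVec d => x.flat s := by
  unfold BlockVec.flat
  fun_prop

theorem contDiff_A (P : QuadConstrainedProblem d nc nz) : ContDiff ℝ 2 P.A := by
  refine contDiff_piLp' _ fun i => ?_
  have := contDiff_flat (d := d)
  simp only [A, dotProduct, Matrix.mulVec]
  refine ((ContDiff.div_const (ContDiff.sum fun s _ => (this s).mul
    (ContDiff.sum fun t _ => contDiff_const.mul (this t))) 2).add ?_).add contDiff_const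
  exact contDiff_const.inner ℝ contDiff_id

/-- `quad` is the second difference A(y) + A(-y) - 2A(0), which vanishes for a map affine in the
block. This is what makes each block subproblem strongly convex. -/
theorem quad_single (P : QuadConstrainedProblem d nc nz) (hP : P.IsMultiAffine) (j : Fin n)
    (y : EuclideanSpace ℝ (Fin (d j))) : P.quad (PiLp.single 2 j y) = 0 := by
  obtain ⟨g, hg⟩ := hP j 0
  have e : ∀ t : ℝ, P.A (0 + t • PiLp.single 2 j y) = g (t • y) := fun t => by
    rw [← hg]
    congr 1
    ext i a
    by_cases h : i = j
    · subst h; simp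
    · simp [h]
  have e0 := e 0
  have e1 := e 1
  have e2 := e (-1)
  rw [A_add_smul] at e0 e1 e2
  have l1 := g.map_vadd 0 y
  have l2 := g.map_vadd 0 (-y)
  simp only [vadd_eq_add, add_zero, map_neg] at l1 l2
  simp only [one_smul, neg_smul, zero_smul] at e0 e1 e2
  rw [l1] at e1
  rw [l2] at e2
  norm_num at e0 e1 e2
  have : P.quad (PiLp.single 2 j y) = (P.A 0 + P.dA 0 (PiLp.single 2 j y)
      + (1 / 2 : ℝ) • P.quad (PiLp.single 2 j y)) + (P.A 0 + -P.dA 0 (PiLp.single 2 j y)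
      + (1 / 2 : ℝ) • P.quad (PiLp.single 2 j y)) - (2 : ℝ) • P.A 0 := by module
  rw [this, e1, e2, e0]
  module

theorem norm_toLp_flat (x : BlockVec d) :
    ‖(WithLp.toLp 2 x.flat : EuclideanSpace ℝ (Σ i : Fin n, Fin (d i)))‖ = ‖x‖ := by
  rw [← sq_eq_sq₀ (norm_nonneg _) (norm_nonneg _), EuclideanSpace.norm_sq_eq,
    PiLp.norm_sq_eq_of_L2, Fintype.sum_sigma]
  simp [EuclideanSpace.norm_sq_eq, BlockVec.flat]

theorem spectralNorm₂_le_normC (P : QuadConstrainedProblem d nc nz) (i : Fin nc) :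
    spectralNorm₂ (P.C i) ≤ P.normC :=
  le_ciSup (f := fun i => spectralNorm₂ (P.C i)) (Set.finite_range _).bddAbove i

theorem normC_nonneg (P : QuadConstrainedProblem d nc nz) : 0 ≤ P.normC :=
  Real.iSup_nonneg fun _ => Matrix.spectralNorm₂_nonneg _

theorem normLin_nonneg (P : QuadConstrainedProblem d nc nz) : 0 ≤ P.normLin :=
  Real.iSup_nonneg fun _ => norm_nonneg _

theorem normConst_nonneg (P : QuadConstrainedProblem d nc nz) : 0 ≤ P.normConst :=
  Real.iSup_nonneg fun _ => abs_nonneg _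

theorem abs_quad_apply_le (P : QuadConstrainedProblem d nc nz) (h : BlockVec d) (i : Fin nc) :
    |P.quad h i| ≤ P.normC * ‖h‖ ^ 2 := by
  have e : P.quad h i = inner ℝ ((P.C i).mulE (WithLp.toLp 2 h.flat)) (WithLp.toLp 2 h.flat) := by
    simp [quad, Matrix.mulE_apply, EuclideanSpace.inner_eq_star_dotProduct]
  rw [e]
  refine (abs_real_inner_le_norm _ _).trans ?_
  have h1 := (P.C i).norm_mulE_apply_le (WithLp.toLp 2 h.flat)
  rw [norm_toLp_flat] at h1 ⊢
  have h2 := P.spectralNorm₂_le_normC i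
  calc _ ≤ spectralNorm₂ (P.C i) * ‖h‖ * ‖h‖ := by gcongr
    _ ≤ P.normC * ‖h‖ * ‖h‖ := by gcongr
    _ = _ := by ring

theorem abs_inner_quad_le (P : QuadConstrainedProblem d nc nz) (v : EuclideanSpace ℝ (Fin nc))
    (h : BlockVec d) : |inner ℝ v (P.quad h)| ≤ √nc * ‖v‖ * P.normC * ‖h‖ ^ 2 := by
  refine (abs_real_inner_le_norm _ _).trans ?_
  have := EuclideanSpace.norm_le_sqrt_mul (mul_nonneg P.normC_nonneg (sq_nonneg ‖h‖))
    (P.abs_quad_apply_le h)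
  calc _ ≤ ‖v‖ * (√nc * (P.normC * ‖h‖ ^ 2)) := by gcongr
    _ = _ := by ring

theorem norm_A_le (P : QuadConstrainedProblem d nc nz) (x : BlockVec d) :
    ‖P.A x‖ ≤ √nc * (P.normC * ‖x‖ ^ 2 + (‖x‖ * P.normLin + P.normConst)) := by
  have h0 := P.normC_nonneg
  have h1 := P.normLin_nonneg
  have h2 := P.normConst_nonneg
  refine EuclideanSpace.norm_le_sqrt_mul (by positivity) fun i => ?_
  have a1 := P.abs_quad_apply_le x i
  have a2 : |inner ℝ (P.lin i) x| ≤ ‖x‖ * P.normLin := by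
    refine (abs_real_inner_le_norm _ _).trans ?_
    rw [mul_comm]
    gcongr
    exact le_ciSup (f := fun i => ‖P.lin i‖) (Set.finite_range _).bddAbove i
  have a3 : |P.const i| ≤ P.normConst :=
    le_ciSup (f := fun i => |P.const i|) (Set.finite_range _).bddAbove i
  have e : P.A x i = P.quad x i / 2 + inner ℝ (P.lin i) x + P.const i := rfl
  rw [e]
  rw [abs_le] at *
  constructor <;> linarith [a1.1, a1.2, a2.1, a2.2, a3.1, a3.2]

end QuadConstrainedProblem

/-! ### The smooth part of the Lagrangian and block sweeps -/

namespace QuadConstrainedProblem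

variable {n : ℕ} {d : Fin n → ℕ} {nc nz : ℕ}

/-- The finite part of the augmented Lagrangian, as a function of `(x, z, w)`. -/
noncomputable def smoothLag (P : QuadConstrainedProblem d nc nz) (ρ : ℝ)
    (p : BlockVec d × EuclideanSpace ℝ (Fin nz) × EuclideanSpace ℝ (Fin nc)) : ℝ :=
  P.f p.1 + (P.φ p.2.1 + inner ℝ p.2.2 (P.residual p.1 p.2.1)
    + ρ / 2 * ‖P.residual p.1 p.2.1‖ ^ 2)

theorem residual_eq (P : QuadConstrainedProblem d nc nz) (x : BlockVec d)
    (z : EuclideanSpace ℝ (Fin nz)) : P.residual x z = P.A x + P.Q.mulE z := rfl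

theorem F_of_mem (P : QuadConstrainedProblem d nc nz) {x : BlockVec d} (h : ∀ i, x i ∈ P.X i) :
    P.F x = (P.f x : EReal) := by
  simp [F, indic, h]

theorem F_of_not_mem (P : QuadConstrainedProblem d nc nz) {x : BlockVec d}
    (h : ¬ ∀ i, x i ∈ P.X i) : P.F x = ⊤ := by
  push Not at h
  obtain ⟨i, hi⟩ := h
  have h0 : ∀ j, 0 ≤ P.indic j (x j) := fun j => by
    unfold indic; split_ifs <;> simp
  have : ∑ i, P.indic i (x i) = ⊤ := by
    refine top_le_iff.1 ?_
    calc ⊤ = P.indic i (x i) := by simp [indic, hi]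
      _ ≤ _ := Finset.single_le_sum (f := fun j => P.indic j (x j)) (fun j _ => h0 j)
        (Finset.mem_univ i)
  rw [F, this, EReal.coe_add_top]

theorem lagrangian_of_mem (P : QuadConstrainedProblem d nc nz) (ρ : ℝ) {x : BlockVec d}
    (h : ∀ i, x i ∈ P.X i) (z : EuclideanSpace ℝ (Fin nz)) (w : EuclideanSpace ℝ (Fin nc)) :
    P.lagrangian ρ x z w = (P.smoothLag ρ (x, z, w) : EReal) := by
  rw [lagrangian, P.F_of_mem h, smoothLag, EReal.coe_add (P.f x)]

theorem lagrangian_of_not_mem (P : QuadConstrainedProblem d nc nz) (ρ : ℝ) {x : BlockVec d}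
    (h : ¬ ∀ i, x i ∈ P.X i) (z : EuclideanSpace ℝ (Fin nz)) (w : EuclideanSpace ℝ (Fin nc)) :
    P.lagrangian ρ x z w = ⊤ := by
  rw [lagrangian, P.F_of_not_mem h, EReal.top_add_coe]

theorem contDiff_smoothLag (P : QuadConstrainedProblem d nc nz) (ρ : ℝ) (hf : ContDiff ℝ 2 P.f)
    (hφ : ContDiff ℝ 2 P.φ) : ContDiff ℝ 2 (P.smoothLag ρ) := by
  have hr : ContDiff ℝ 2 fun p : BlockVec d × EuclideanSpace ℝ (Fin nz) ×
      EuclideanSpace ℝ (Fin nc) => P.residual p.1 p.2.1 :=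
    (P.contDiff_A.comp contDiff_fst).add (P.Q.mulE.contDiff.comp contDiff_snd.fst)
  exact (hf.comp contDiff_fst).add (((hφ.comp contDiff_snd.fst).add
    (contDiff_snd.snd.inner ℝ hr)).add (contDiff_const.mul (hr.norm_sq ℝ)))

theorem residual_line (P : QuadConstrainedProblem d nc nz) (x h : BlockVec d)
    (z k : EuclideanSpace ℝ (Fin nz)) (t : ℝ) :
    P.residual (x + t • h) (z + t • k) =
      P.residual x z + t • (P.dA x h + P.Q.mulE k) + (t ^ 2 / 2) • P.quad h := by
  rw [residual_eq, residual_eq, A_add_smul, map_add, map_smul]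
  module

/-- The constraint enters only through w + ρR, which at a new iterate is the updated multiplier. -/
theorem fderiv_smoothLag_apply (P : QuadConstrainedProblem d nc nz) (ρ : ℝ)
    (hf : ContDiff ℝ 2 P.f) (hφ : ContDiff ℝ 2 P.φ) (x h : BlockVec d)
    (z k : EuclideanSpace ℝ (Fin nz)) (w : EuclideanSpace ℝ (Fin nc)) :
    fderiv ℝ (P.smoothLag ρ) (x, z, w) (h, k, 0) =
      fderiv ℝ P.f x h + fderiv ℝ P.φ z k
        + inner ℝ (w + ρ • P.residual x z) (P.dA x h + P.Q.mulE k) := by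
  have hL := (((P.contDiff_smoothLag ρ hf hφ).differentiable two_ne_zero)
    (x, z, w)).hasFDerivAt.hasDerivAt_line (h, k, 0)
  have h1 := ((hf.differentiable two_ne_zero) x).hasFDerivAt.hasDerivAt_line h
  have h2 := ((hφ.differentiable two_ne_zero) z).hasFDerivAt.hasDerivAt_line k
  have h3 : HasDerivAt (fun t : ℝ => P.residual (x + t • h) (z + t • k))
      (P.dA x h + P.Q.mulE k) 0 := by
    simp only [residual_line]
    have a := ((hasDerivAt_id (0 : ℝ)).smul_const (P.dA x h + P.Q.mulE k)).const_add
      (P.residual x z)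
    have b := (((hasDerivAt_id (0 : ℝ)).pow 2).div_const 2).smul_const (P.quad h)
    simpa using! a.add b
  have h4 := (hasDerivAt_const (0 : ℝ) w).inner ℝ h3
  have h5 := h3.norm_sq.const_mul (ρ / 2)
  have h6 := h1.add ((h2.add h4).add h5)
  have e : (fun t : ℝ => P.smoothLag ρ ((x, z, w) + t • (h, k, 0))) =
      fun t : ℝ => P.f (x + t • h) + (P.φ (z + t • k)
        + inner ℝ w (P.residual (x + t • h) (z + t • k))
        + ρ / 2 * ‖P.residual (x + t • h) (z + t • k)‖ ^ 2) := by
    funext t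
    simp [smoothLag]
  rw [e] at hL
  rw [hL.unique h6]
  simp only [inner_zero_left, zero_smul, add_zero, inner_add_left, inner_smul_left]
  simp
  ring

/-- Expand the penalty around R and drop the square of the increment of R: the strong-convexity
terms survive, and only the pairing with `quad` has no sign. -/
theorem smoothLag_add_ge (P : QuadConstrainedProblem d nc nz) {ρ μf μφ : ℝ} (hρ : 0 ≤ ρ)
    (hf : ContDiff ℝ 2 P.f) (hφ : ContDiff ℝ 2 P.φ) (hfc : StrongConvexOn Set.univ μf P.f)
    (hφc : StrongConvexOn Set.univ μφ P.φ) (x h : BlockVec d)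
    (z k : EuclideanSpace ℝ (Fin nz)) (w : EuclideanSpace ℝ (Fin nc)) :
    P.smoothLag ρ (x, z, w) + fderiv ℝ (P.smoothLag ρ) (x, z, w) (h, k, 0)
      + μf / 2 * ‖h‖ ^ 2 + μφ / 2 * ‖k‖ ^ 2
      + 1 / 2 * inner ℝ (w + ρ • P.residual x z) (P.quad h) ≤ P.smoothLag ρ (x + h, z + k, w) := by
  rw [P.fderiv_smoothLag_apply ρ hf hφ]
  have h1 := hfc.add_fderiv_add_le ((hf.differentiable two_ne_zero) x).hasFDerivAt h
  have h2 := hφc.add_fderiv_add_le ((hφ.differentiable two_ne_zero) z).hasFDerivAt k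
  have h3 := P.residual_line x h z k 1
  simp only [one_smul, one_pow] at h3
  simp only [smoothLag]
  rw [h3]
  set V := P.dA x h + P.Q.mulE k
  set R := P.residual x z
  have e : R + V + (1 / 2 : ℝ) • P.quad h = R + (V + (1 / 2 : ℝ) • P.quad h) := by module
  rw [e, norm_add_sq_real]
  have h4 : 0 ≤ ρ / 2 * ‖V + (1 / 2 : ℝ) • P.quad h‖ ^ 2 := by positivity
  simp only [inner_add_left, inner_add_right, inner_smul_left, inner_smul_right,
    RCLike.conj_to_real]
  linarith

/-- The point whose first `m` blocks are those of `x'` and whose other blocks are those of `x`. -/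
def partialSweep (x x' : BlockVec d) (m : ℕ) : BlockVec d :=
  WithLp.toLp 2 fun j => if j.val < m then x' j else x j

theorem partialSweep_zero (x x' : BlockVec d) : partialSweep x x' 0 = x := by
  ext j; simp [partialSweep]

theorem partialSweep_self (x x' : BlockVec d) : partialSweep x x' n = x' := by
  ext j; simp [partialSweep]

/-- The base point already contains the new i-th block, so minimality becomes a first-order
condition there. -/
theorem sweep_eq_partialSweep_succ_add (x x' : BlockVec d) (i : Fin n)
    (y : EuclideanSpace ℝ (Fin (d i))) :
    sweep x x' i y = partialSweep x x' (i + 1) + PiLp.single 2 i (y - x' i) := by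
  ext j a
  by_cases h : j = i
  · subst h; simp [sweep, partialSweep]
  · have : j < i ↔ j.val < i.val + 1 := by
      rw [Fin.lt_def]; have := Fin.val_ne_of_ne h; omega
    simp [sweep, partialSweep, h, this]

theorem sweep_new (x x' : BlockVec d) (i : Fin n) :
    sweep x x' i (x' i) = partialSweep x x' (i + 1) := by
  rw [sweep_eq_partialSweep_succ_add, sub_self]
  ext j a
  by_cases h : j = i
  · subst h; simp
  · simp [h]

theorem sweep_old (x x' : BlockVec d) (i : Fin n) :
    sweep x x' i (x i) = partialSweep x x' i := by
  ext j a
  by_cases h : j = i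
  · subst h; simp [sweep, partialSweep]
  · simp [sweep, partialSweep, h]

theorem partialSweep_eq_succ_add (x x' : BlockVec d) (i : Fin n) :
    partialSweep x x' i = partialSweep x x' (i + 1) + PiLp.single 2 i (x i - x' i) := by
  rw [← sweep_old, sweep_eq_partialSweep_succ_add]

theorem norm_sub_partialSweep_le (x x' : BlockVec d) (m : ℕ) :
    ‖x' - partialSweep x x' m‖ ≤ ‖x' - x‖ := by
  rw [← sq_le_sq₀ (norm_nonneg _) (norm_nonneg _), PiLp.norm_sq_eq_of_L2, PiLp.norm_sq_eq_of_L2]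
  refine Finset.sum_le_sum fun j _ => ?_
  by_cases h : j.val < m <;> simp [partialSweep, h]

theorem mem_partialSweep (P : QuadConstrainedProblem d nc nz) {x x' : BlockVec d}
    (hx : ∀ i, x i ∈ P.X i) (hx' : ∀ i, x' i ∈ P.X i) (m : ℕ) (i : Fin n) :
    partialSweep x x' m i ∈ P.X i := by
  by_cases h : i.val < m <;> simp [partialSweep, h, hx, hx']

theorem sum_single (h : BlockVec d) : ∑ i, PiLp.single 2 i (h i) = h := by
  ext j a
  simp [Finset.sum_apply]

end QuadConstrainedProblem

/-! ### Topology and convexity of polyhedral sets -/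

theorem IsPolyhedralSet.isClosed {p : ℕ} {S : Set (EuclideanSpace ℝ (Fin p))}
    (hS : IsPolyhedralSet S) : IsClosed S := by
  obtain ⟨m, A, b, rfl⟩ := hS
  rw [Set.ofPred_forall]
  refine isClosed_iInter fun j => isClosed_le ?_ continuous_const
  exact (EuclideanSpace.proj (𝕜 := ℝ) j).continuous.comp A.mulE.continuous

theorem IsPolyhedralSet.convex {p : ℕ} {S : Set (EuclideanSpace ℝ (Fin p))}
    (hS : IsPolyhedralSet S) : Convex ℝ S := by
  obtain ⟨m, A, b, rfl⟩ := hS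
  rw [Set.ofPred_forall]
  refine convex_iInter fun j => ?_
  exact convex_halfSpace_le ((EuclideanSpace.proj (𝕜 := ℝ) j).comp A.mulE).isLinear (b j)

/-! ### ADMM: optimality conditions, dual invariant and descent -/

namespace QuadConstrainedProblem

variable {n : ℕ} {d : Fin n → ℕ} {nc nz : ℕ}

/-- The standing assumptions on the problem and on the ADMM iterates, without the smallness
condition on the quadratic part. -/
structure AdmmSetting (P : QuadConstrainedProblem d nc nz) (μf μφ Lφ ρ : ℝ) (xf : BlockVec d)
    (zφ : EuclideanSpace ℝ (Fin nz)) (x : ℕ → BlockVec d) (z : ℕ → EuclideanSpace ℝ (Fin nz))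
    (w : ℕ → EuclideanSpace ℝ (Fin nc)) : Prop where
  multiAffine : P.IsMultiAffine
  contDiff_f : ContDiff ℝ 2 P.f
  μf_pos : 0 < μf
  f_convex : StrongConvexOn Set.univ μf P.f
  xf_min : IsMinOn P.f Set.univ xf
  contDiff_φ : ContDiff ℝ 2 P.φ
  μφ_pos : 0 < μφ
  φ_convex : StrongConvexOn Set.univ μφ P.φ
  zφ_min : IsMinOn P.φ Set.univ zφ
  Lφ_pos : 0 < Lφ
  φ_smooth : IsLSmooth Lφ P.φ
  polyhedral : ∀ i, IsPolyhedralSet (P.X i)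
  rank : P.Q.rank = nc
  ρ_pos : 0 < ρ
  ρ_ge : 4 * Lφ ^ 2 / (μφ * lambdaMinPos (P.Q.transpose * P.Q)) ≤ ρ
  admm : P.IsADMM ρ x z w
  mem_zero : ∀ i, x 0 i ∈ P.X i
  residual_zero : P.residual (x 0) (z 0) = 0
  dual_zero : P.Q.transpose.mulE (w 0) = -gradient P.φ (z 0)

namespace AdmmSetting

variable {P : QuadConstrainedProblem d nc nz} {μf μφ Lφ ρ : ℝ} {xf : BlockVec d}
    {zφ : EuclideanSpace ℝ (Fin nz)} {x : ℕ → BlockVec d} {z : ℕ → EuclideanSpace ℝ (Fin nz)}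
    {w : ℕ → EuclideanSpace ℝ (Fin nc)}

/-- Once the earlier new blocks are feasible, keeping the old i-th block gives a finite value, so
the minimizing block cannot have value ⊤. -/
theorem mem_succ (S : AdmmSetting P μf μφ Lφ ρ xf zφ x z w) {k : ℕ} (hk : ∀ i, x k i ∈ P.X i)
    (i : Fin n) : x (k + 1) i ∈ P.X i := by
  induction i using Fin.strong_induction_on with
  | _ i ih =>
    have hold : ∀ j, sweep (x k) (x (k + 1)) i (x k i) j ∈ P.X j := fun j => by
      rw [sweep_old]
      by_cases h : j.val < i.val
      · simpa only [partialSweep, h, if_true] using ih j h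
      · simpa only [partialSweep, h, if_false] using hk j
    have h := isMinOn_iff.1 (S.admm.x_step k i) (x k i) (Set.mem_univ _)
    simp only at h
    rw [P.lagrangian_of_mem ρ hold] at h
    by_contra hi
    rw [P.lagrangian_of_not_mem ρ (fun hall => hi (by simpa [sweep] using hall i))] at h
    exact absurd (top_le_iff.1 h) (EReal.coe_ne_top _)

theorem mem (S : AdmmSetting P μf μφ Lφ ρ xf zφ x z w) (k : ℕ) : ∀ i, x k i ∈ P.X i := by
  induction k with
  | zero => exact S.mem_zero
  | succ k ih => exact S.mem_succ ih

theorem differentiable (S : AdmmSetting P μf μφ Lφ ρ xf zφ x z w) :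
    Differentiable ℝ (P.smoothLag ρ) :=
  (P.contDiff_smoothLag ρ S.contDiff_f S.contDiff_φ).differentiable two_ne_zero

theorem fderiv_block_nonneg (S : AdmmSetting P μf μφ Lφ ρ xf zφ x z w) (k : ℕ) (i : Fin n)
    {y : EuclideanSpace ℝ (Fin (d i))} (hy : y ∈ P.X i) :
    0 ≤ fderiv ℝ (P.smoothLag ρ) (partialSweep (x k) (x (k + 1)) (i + 1), z k, w k)
      (PiLp.single 2 i (y - x (k + 1) i), 0, 0) := by
  refine nonneg_of_hasDerivAt_of_min_left ((S.differentiable _).hasFDerivAt.hasDerivAt_line _)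
    fun t ht => ?_
  have hmem : x (k + 1) i + t • (y - x (k + 1) i) ∈ P.X i :=
    (S.polyhedral i).convex.add_smul_sub_mem (S.mem (k + 1) i) hy ht
  have h := isMinOn_iff.1 (S.admm.x_step k i) (x (k + 1) i + t • (y - x (k + 1) i))
    (Set.mem_univ _)
  simp only at h
  have hT := P.mem_partialSweep (S.mem k) (S.mem (k + 1)) (i + 1)
  have hT' : ∀ j, sweep (x k) (x (k + 1)) i (x (k + 1) i + t • (y - x (k + 1) i)) j ∈ P.X j := by
    intro j
    by_cases h : j = i
    · subst h; simpa [sweep] using hmem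
    · simp only [sweep, Function.update_of_ne h]
      split_ifs
      exacts [S.mem _ _, S.mem _ _]
  rw [P.lagrangian_of_mem ρ hT', sweep_new, P.lagrangian_of_mem ρ hT,
    sweep_eq_partialSweep_succ_add, EReal.coe_le_coe_iff] at h
  have e : PiLp.single 2 i (x (k + 1) i + t • (y - x (k + 1) i) - x (k + 1) i) =
      t • (PiLp.single 2 i (y - x (k + 1) i) : BlockVec d) := by
    ext j a
    by_cases h : j = i
    · subst h; simp
    · simp [h]
  rw [e] at h
  simpa using h

theorem fderiv_z_eq_zero (S : AdmmSetting P μf μφ Lφ ρ xf zφ x z w) (k : ℕ)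
    (v : EuclideanSpace ℝ (Fin nz)) :
    fderiv ℝ (P.smoothLag ρ) (x (k + 1), z (k + 1), w k) (0, v, 0) = 0 := by
  have key : ∀ v : EuclideanSpace ℝ (Fin nz),
      0 ≤ fderiv ℝ (P.smoothLag ρ) (x (k + 1), z (k + 1), w k) (0, v, 0) := fun v => by
    refine nonneg_of_hasDerivAt_of_min_left ((S.differentiable _).hasFDerivAt.hasDerivAt_line _)
      fun t _ => ?_
    have h := isMinOn_iff.1 (S.admm.z_step k) (z (k + 1) + t • v) (Set.mem_univ _)
    rw [P.lagrangian_of_mem ρ (S.mem (k + 1)), P.lagrangian_of_mem ρ (S.mem (k + 1)),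
      EReal.coe_le_coe_iff] at h
    simpa using h
  have h2 := key (-v)
  have e : ((0 : BlockVec d), -v, (0 : EuclideanSpace ℝ (Fin nc))) = -(0, v, 0) := by simp
  rw [e, map_neg] at h2
  linarith [key v]

/-- Stationarity of the z-step reads ∇φ(z) + Qᵀ(wᵏ + ρR) = 0, and wᵏ + ρR is wᵏ⁺¹; the case k = 0 is
the initialization. -/
theorem dual_eq (S : AdmmSetting P μf μφ Lφ ρ xf zφ x z w) (k : ℕ) :
    P.Q.transpose.mulE (w k) = -gradient P.φ (z k) := by
  cases k with
  | zero => exact S.dual_zero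
  | succ k =>
    rw [eq_neg_iff_add_eq_zero]
    refine ext_inner_right ℝ fun v => ?_
    have h := S.fderiv_z_eq_zero k v
    rw [P.fderiv_smoothLag_apply ρ S.contDiff_f S.contDiff_φ, ← S.admm.w_step k,
      fderiv_apply_eq_inner_gradient (g := P.φ)] at h
    have e : P.dA (x (k + 1)) 0 = 0 := by
      ext i
      have : BlockVec.flat (0 : BlockVec d) = 0 := rfl
      simp [dA, this]
    rw [e, zero_add, map_zero, zero_add, real_inner_comm _ (w (k + 1)), Matrix.inner_mulE,
      real_inner_comm] at h
    rw [inner_add_left, inner_zero_left, real_inner_comm, real_inner_comm v, add_comm]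
    exact h

theorem norm_dual_le (S : AdmmSetting P μf μφ Lφ ρ xf zφ x z w) (k : ℕ) :
    ‖w k‖ ≤ P.normPinv * ‖gradient P.φ (z k)‖ := by
  have h := ((P.Q * P.Q.transpose)⁻¹ * P.Q).norm_mulE_apply_le (P.Q.transpose.mulE (w k))
  rwa [Matrix.pinv_mulE_transpose S.rank, S.dual_eq, norm_neg] at h

theorem norm_dual_le' (S : AdmmSetting P μf μφ Lφ ρ xf zφ x z w) (k : ℕ) :
    ‖w k‖ ≤ P.normPinv * (Lφ * ‖z k - zφ‖) := by
  refine (S.norm_dual_le k).trans ?_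
  have h := S.φ_smooth (z k) zφ
  rw [S.zφ_min.gradient_eq_zero, sub_zero] at h
  exact mul_le_mul_of_nonneg_left h (Matrix.spectralNorm₂_nonneg _)

theorem norm_dual_sub_le (S : AdmmSetting P μf μφ Lφ ρ xf zφ x z w) (k l : ℕ) :
    ‖w k - w l‖ ≤ P.normPinv * (Lφ * ‖z k - z l‖) := by
  have h := ((P.Q * P.Q.transpose)⁻¹ * P.Q).norm_mulE_apply_le
    (P.Q.transpose.mulE (w k - w l))
  rw [Matrix.pinv_mulE_transpose S.rank, map_sub, S.dual_eq, S.dual_eq, neg_sub_neg,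
    norm_sub_rev (gradient P.φ (z l))] at h
  exact h.trans (mul_le_mul_of_nonneg_left (S.φ_smooth _ _) (Matrix.spectralNorm₂_nonneg _))

theorem norm_sq_le_norm_sq_transpose (S : AdmmSetting P μf μφ Lφ ρ xf zφ x z w)
    (u : EuclideanSpace ℝ (Fin nc)) :
    4 * Lφ ^ 2 * ‖u‖ ^ 2 ≤ ρ * μφ * ‖P.Q.transpose.mulE u‖ ^ 2 := by
  have hμ := S.μφ_pos
  have hρ := S.ρ_pos
  -- For nc = 0 there is no positive eigenvalue, `lambdaMinPos` is `sInf ∅ = 0`, and the bound on ρ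
  -- is void; but then u = 0.
  rcases Nat.eq_zero_or_pos nc with h0 | hc
  · subst h0
    rw [Subsingleton.elim u 0]
    simp
  · have h1 := S.ρ_ge
    have hl := Matrix.lambdaMin_pos (Matrix.posDef_mul_transpose_of_rank_eq S.rank) hc
    rw [Matrix.lambdaMinPos_transpose_mul_self S.rank, div_le_iff₀ (by positivity)] at h1
    have h2 := Matrix.lambdaMin_mul_norm_sq_le_transpose P.Q u
    calc _ ≤ ρ * (μφ * lambdaMin (P.Q * P.Q.transpose)) * ‖u‖ ^ 2 := by gcongr
      _ = ρ * μφ * (lambdaMin (P.Q * P.Q.transpose) * ‖u‖ ^ 2) := by ring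
      _ ≤ _ := by gcongr

/-- Expand at the new point towards the old one: the first-order term is nonnegative by optimality
and the curvature vanishes along a block. -/
theorem block_descent (S : AdmmSetting P μf μφ Lφ ρ xf zφ x z w) (k : ℕ) (i : Fin n) :
    P.smoothLag ρ (partialSweep (x k) (x (k + 1)) (i + 1), z k, w k)
      + μf / 2 * ‖x (k + 1) i - x k i‖ ^ 2
      ≤ P.smoothLag ρ (partialSweep (x k) (x (k + 1)) i, z k, w k) := by
  have h1 := S.fderiv_block_nonneg k i (S.mem k i)
  have h2 := P.smoothLag_add_ge S.ρ_pos.le S.contDiff_f S.contDiff_φ S.f_convex S.φ_convex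
    (partialSweep (x k) (x (k + 1)) (i + 1)) (PiLp.single 2 i (x k i - x (k + 1) i)) (z k) 0 (w k)
  rw [P.quad_single S.multiAffine, ← partialSweep_eq_succ_add, inner_zero_right, add_zero,
    norm_zero, PiLp.norm_single, norm_sub_rev] at h2
  linarith

theorem x_descent (S : AdmmSetting P μf μφ Lφ ρ xf zφ x z w) (k : ℕ) :
    P.smoothLag ρ (x (k + 1), z k, w k) + μf / 2 * ‖x (k + 1) - x k‖ ^ 2
      ≤ P.smoothLag ρ (x k, z k, w k) := by
  set a : ℕ → ℝ := fun m => P.smoothLag ρ (partialSweep (x k) (x (k + 1)) m, z k, w k) with ha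
  have h1 : ∑ i : Fin n, μf / 2 * ‖x (k + 1) i - x k i‖ ^ 2
      ≤ ∑ i : Fin n, (a i - a (i + 1)) :=
    Finset.sum_le_sum fun i _ => by
      have := S.block_descent k i
      simp only [ha]
      linarith
  rw [← Finset.mul_sum, Fin.sum_univ_eq_sum_range (fun m => a m - a (m + 1)),
    Finset.sum_range_sub'] at h1
  simp only [ha, partialSweep_zero, partialSweep_self] at h1
  rw [PiLp.norm_sq_eq_of_L2]
  simp only [PiLp.sub_apply]
  linarith

theorem z_descent (S : AdmmSetting P μf μφ Lφ ρ xf zφ x z w) (k : ℕ) :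
    P.smoothLag ρ (x (k + 1), z (k + 1), w k) + μφ / 2 * ‖z (k + 1) - z k‖ ^ 2
      ≤ P.smoothLag ρ (x (k + 1), z k, w k) := by
  have h2 := P.smoothLag_add_ge S.ρ_pos.le S.contDiff_f S.contDiff_φ S.f_convex S.φ_convex
    (x (k + 1)) 0 (z (k + 1)) (z k - z (k + 1)) (w k)
  have h3 : P.quad 0 = 0 := by
    ext i
    have : BlockVec.flat (0 : BlockVec d) = 0 := rfl
    simp [quad, this]
  rw [S.fderiv_z_eq_zero, h3, inner_zero_right, norm_zero, add_zero, add_zero, add_sub_cancel,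
    norm_sub_rev] at h2
  linarith

/-- The dual update raises L by ρ‖R‖² = ‖Δw‖²/ρ. Since QᵀΔw = -Δ∇φ, the choice of ρ bounds this by
half of the gain of the z-step. -/
theorem w_ascent (S : AdmmSetting P μf μφ Lφ ρ xf zφ x z w) (k : ℕ) :
    P.smoothLag ρ (x (k + 1), z (k + 1), w (k + 1))
      ≤ P.smoothLag ρ (x (k + 1), z (k + 1), w k) + μφ / 4 * ‖z (k + 1) - z k‖ ^ 2 := by
  have hρ := S.ρ_pos
  set R := P.residual (x (k + 1)) (z (k + 1)) with hR
  have hw : w (k + 1) - w k = ρ • R := by rw [S.admm.w_step k, add_sub_cancel_left]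
  have e : P.smoothLag ρ (x (k + 1), z (k + 1), w (k + 1))
      = P.smoothLag ρ (x (k + 1), z (k + 1), w k) + ρ * ‖R‖ ^ 2 := by
    simp only [smoothLag, ← hR]
    rw [S.admm.w_step k, ← hR, inner_add_left, inner_smul_left, real_inner_self_eq_norm_sq]
    simp only [RCLike.conj_to_real]
    ring
  have h1 := S.norm_sq_le_norm_sq_transpose (w (k + 1) - w k)
  rw [map_sub, S.dual_eq, S.dual_eq, neg_sub_neg,
    norm_sub_rev (gradient P.φ (z k)), hw, norm_smul, mul_pow,
    Real.norm_of_nonneg hρ.le] at h1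
  have h2 := pow_le_pow_left₀ (norm_nonneg _) (S.φ_smooth (z (k + 1)) (z k)) 2
  have h3 : ρ * Lφ ^ 2 * (4 * (ρ * ‖R‖ ^ 2)) ≤ ρ * Lφ ^ 2 * (μφ * ‖z (k + 1) - z k‖ ^ 2) := by
    have := mul_le_mul_of_nonneg_left h2 (mul_pos hρ S.μφ_pos).le
    linarith
  have h4 := le_of_mul_le_mul_left h3 (mul_pos hρ (pow_pos S.Lφ_pos 2))
  linarith

theorem descent (S : AdmmSetting P μf μφ Lφ ρ xf zφ x z w) (k : ℕ) :
    P.smoothLag ρ (x (k + 1), z (k + 1), w (k + 1))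
      + (μf / 2 * ‖x (k + 1) - x k‖ ^ 2 + μφ / 4 * ‖z (k + 1) - z k‖ ^ 2)
      ≤ P.smoothLag ρ (x k, z k, w k) := by
  linarith [S.x_descent k, S.z_descent k, S.w_ascent k]

/-- Completing the square, ⟨w, R⟩ + (ρ/2)‖R‖² ≥ -‖w‖²/(2ρ) ≥ -(μ_φ/8)‖z - z_φ‖², using the dual
invariant. This leaves 3/8 of the μ_φ/2 supplied by φ. -/
theorem smoothLag_ge (S : AdmmSetting P μf μφ Lφ ρ xf zφ x z w) (k : ℕ) :
    P.f xf + P.φ zφ + (μf / 2 * ‖x k - xf‖ ^ 2 + 3 / 8 * μφ * ‖z k - zφ‖ ^ 2)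
      ≤ P.smoothLag ρ (x k, z k, w k) := by
  have hρ := S.ρ_pos
  have h1 := S.f_convex.add_norm_sq_le_of_isMinOn
    (S.contDiff_f.differentiable two_ne_zero _) S.xf_min (x k)
  have h2 := S.φ_convex.add_norm_sq_le_of_isMinOn
    (S.contDiff_φ.differentiable two_ne_zero _) S.zφ_min (z k)
  have h3 := S.norm_sq_le_norm_sq_transpose (w k)
  have h4 := S.φ_smooth (z k) zφ
  rw [S.zφ_min.gradient_eq_zero, sub_zero] at h4
  rw [S.dual_eq, norm_neg] at h3
  have h5 := pow_le_pow_left₀ (norm_nonneg _) h4 2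
  have h6 : Lφ ^ 2 * (4 * ‖w k‖ ^ 2) ≤ Lφ ^ 2 * (ρ * (μφ * ‖z k - zφ‖ ^ 2)) := by
    have := mul_le_mul_of_nonneg_left h5 (mul_pos hρ S.μφ_pos).le
    linarith
  have h7 := le_of_mul_le_mul_left h6 (pow_pos S.Lφ_pos 2)
  set R := P.residual (x k) (z k)
  have h8 : 0 ≤ ‖w k + ρ • R‖ ^ 2 := sq_nonneg _
  rw [norm_add_sq_real, inner_smul_right, norm_smul, mul_pow, Real.norm_of_nonneg hρ.le] at h8
  have h9 : ρ * (-(μφ * ‖z k - zφ‖ ^ 2 / 8)) ≤ ρ * (inner ℝ (w k) R + ρ / 2 * ‖R‖ ^ 2) := by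
    linarith
  have h10 := le_of_mul_le_mul_left h9 hρ
  simp only [smoothLag]
  linarith

end AdmmSetting
end QuadConstrainedProblem

/-! ### Boundedness and approximate global minimality of the iterates -/

namespace QuadConstrainedProblem

variable {n : ℕ} {d : Fin n → ℕ} {nc nz : ℕ}

namespace AdmmSetting

variable {P : QuadConstrainedProblem d nc nz} {μf μφ Lφ ρ : ℝ} {xf : BlockVec d}
    {zφ : EuclideanSpace ℝ (Fin nz)} {x : ℕ → BlockVec d} {z : ℕ → EuclideanSpace ℝ (Fin nz)}
    {w : ℕ → EuclideanSpace ℝ (Fin nc)}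

theorem antitone_smoothLag (S : AdmmSetting P μf μφ Lφ ρ xf zφ x z w) :
    Antitone fun k => P.smoothLag ρ (x k, z k, w k) := by
  refine antitone_nat_of_succ_le fun k => ?_
  have hf := S.μf_pos
  have hφ := S.μφ_pos
  have : 0 ≤ μf / 2 * ‖x (k + 1) - x k‖ ^ 2 + μφ / 4 * ‖z (k + 1) - z k‖ ^ 2 := by positivity
  linarith [S.descent k]

theorem smoothLag_zero (S : AdmmSetting P μf μφ Lφ ρ xf zφ x z w) :
    P.smoothLag ρ (x 0, z 0, w 0) = P.f (x 0) + P.φ (z 0) := by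
  simp [smoothLag, S.residual_zero]

theorem dist_sq_le (S : AdmmSetting P μf μφ Lφ ρ xf zφ x z w) (k : ℕ) :
    μf / 2 * ‖x k - xf‖ ^ 2 + 3 / 8 * μφ * ‖z k - zφ‖ ^ 2
      ≤ P.f (x 0) - P.f xf + (P.φ (z 0) - P.φ zφ) := by
  have h1 := S.smoothLag_ge k
  have h2 := S.antitone_smoothLag (Nat.zero_le k)
  simp only [S.smoothLag_zero] at h2
  linarith

theorem exists_norm_bound (S : AdmmSetting P μf μφ Lφ ρ xf zφ x z w) :
    ∃ r : ℝ, 0 ≤ r ∧ ∀ k, ‖x k‖ ≤ r ∧ ‖z k‖ ≤ r ∧ ‖w k‖ ≤ r := by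
  have hf := S.μf_pos
  have hφ := S.μφ_pos
  set D := P.f (x 0) - P.f xf + (P.φ (z 0) - P.φ zφ)
  have hx : ∀ k, ‖x k‖ ≤ √(D / (μf / 2)) + ‖xf‖ := fun k => by
    have h : ‖x k - xf‖ ≤ √(D / (μf / 2)) := by
      refine Real.le_sqrt_of_sq_le ?_
      rw [le_div_iff₀' (by positivity)]
      have : 0 ≤ 3 / 8 * μφ * ‖z k - zφ‖ ^ 2 := by positivity
      linarith [S.dist_sq_le k]
    linarith [norm_le_norm_sub_add (x k) xf]
  have hz : ∀ k, ‖z k - zφ‖ ≤ √(D / (3 / 8 * μφ)) := fun k => by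
    refine Real.le_sqrt_of_sq_le ?_
    rw [le_div_iff₀' (by positivity)]
    have : 0 ≤ μf / 2 * ‖x k - xf‖ ^ 2 := by positivity
    linarith [S.dist_sq_le k]
  have hp : 0 ≤ P.normPinv := Matrix.spectralNorm₂_nonneg _
  have hL := S.Lφ_pos
  refine ⟨(√(D / (μf / 2)) + ‖xf‖) + (√(D / (3 / 8 * μφ)) + ‖zφ‖)
    + P.normPinv * (Lφ * √(D / (3 / 8 * μφ))), by positivity, fun k => ?_⟩
  have h1 : ‖w k‖ ≤ P.normPinv * (Lφ * √(D / (3 / 8 * μφ))) :=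
    (S.norm_dual_le' k).trans (by gcongr; exact hz k)
  have h2 : ‖z k‖ ≤ √(D / (3 / 8 * μφ)) + ‖zφ‖ := by
    linarith [norm_le_norm_sub_add (z k) zφ, hz k]
  have h3 := hx k
  have := norm_nonneg (x k)
  have := norm_nonneg (z k)
  have := norm_nonneg (w k)
  exact ⟨by linarith, by linarith, by linarith⟩

/-- The variational inequality satisfied by the iterates, up to an error proportional to the
length of the last step. -/
theorem exists_fderiv_ge (S : AdmmSetting P μf μφ Lφ ρ xf zφ x z w) :
    ∃ K : ℝ, 0 ≤ K ∧ ∀ (k : ℕ) (y : BlockVec d) (v : EuclideanSpace ℝ (Fin nz)),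
      (∀ i, y i ∈ P.X i) →
      -(K * (‖x (k + 1) - x k‖ + ‖z (k + 1) - z k‖)
          * (‖y - x (k + 1)‖ + ‖v - z (k + 1)‖)) ≤
        fderiv ℝ (P.smoothLag ρ) (x (k + 1), z (k + 1), w (k + 1))
          (y - x (k + 1), v - z (k + 1), 0) := by
  obtain ⟨r, hr, hb⟩ := S.exists_norm_bound
  set G := fderiv ℝ (P.smoothLag ρ) with hG
  have hG1 : ContDiff ℝ 1 G :=
    (P.contDiff_smoothLag ρ S.contDiff_f S.contDiff_φ).fderiv_right (by norm_num)
  -- Radius 3r leaves room for the intermediate sweep points: they lie within ‖xᵏ⁺¹ - xᵏ‖ ≤ 2r of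
  -- xᵏ⁺¹.
  obtain ⟨K, hK⟩ := hG1.contDiffOn.exists_lipschitzOnWith one_ne_zero
    (convex_closedBall (0 : BlockVec d × EuclideanSpace ℝ (Fin nz) × EuclideanSpace ℝ (Fin nc))
      (3 * r)) (isCompact_closedBall _ _)
  set M := P.normPinv * Lφ with hM
  have hM0 : 0 ≤ M := mul_nonneg (Matrix.spectralNorm₂_nonneg _) S.Lφ_pos.le
  refine ⟨K * (1 + M) * (n + 1), by positivity, fun k y v hy => ?_⟩
  set δ := ‖x (k + 1) - x k‖ + ‖z (k + 1) - z k‖ with hδ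
  have hx0 := norm_nonneg (x (k + 1) - x k)
  have hz0 := norm_nonneg (z (k + 1) - z k)
  have hδ0 : 0 ≤ δ := add_nonneg hx0 hz0
  have hMδ : M * ‖z (k + 1) - z k‖ ≤ M * δ := by gcongr; linarith
  have hMδ0 : 0 ≤ M * δ := mul_nonneg hM0 hδ0
  have hw : ‖w (k + 1) - w k‖ ≤ (1 + M) * δ := by
    have := S.norm_dual_sub_le (k + 1) k
    rw [← mul_assoc] at this
    linarith
  have hmem : ∀ a b c, ‖a‖ ≤ 3 * r → ‖b‖ ≤ r → ‖c‖ ≤ r →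
      ((a, b, c) : BlockVec d × EuclideanSpace ℝ (Fin nz) × EuclideanSpace ℝ (Fin nc)) ∈
        Metric.closedBall 0 (3 * r) := fun a b c ha hb' hc => by
    rw [mem_closedBall_zero_iff, Prod.norm_def, Prod.norm_def]
    exact max_le ha (max_le (by linarith) (by linarith))
  have hnew := hmem _ _ _ ((hb (k + 1)).1.trans (by linarith)) (hb (k + 1)).2.1 (hb (k + 1)).2.2
  have hxx : ‖x (k + 1) - x k‖ ≤ 2 * r := by
    linarith [norm_sub_le (x (k + 1)) (x k), (hb (k + 1)).1, (hb k).1]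
  -- Each optimality condition holds at its own intermediate point; Lipschitz continuity of the
  -- derivative transfers it to the new iterate.
  have key : ∀ a b c, ‖a‖ ≤ 3 * r → ‖b‖ ≤ r → ‖c‖ ≤ r → ‖x (k + 1) - a‖ ≤ (1 + M) * δ →
      ‖z (k + 1) - b‖ ≤ (1 + M) * δ → ‖w (k + 1) - c‖ ≤ (1 + M) * δ →
      ∀ u, 0 ≤ G (a, b, c) u →
        -(K * ((1 + M) * δ) * ‖u‖) ≤ G (x (k + 1), z (k + 1), w (k + 1)) u := by
    intro a b c ha hb' hc h1 h2 h3 u hu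
    have h4 := hK.norm_sub_le hnew (hmem a b c ha hb' hc)
    have h5 : ‖(x (k + 1), z (k + 1), w (k + 1)) - (a, b, c)‖ ≤ (1 + M) * δ := by
      rw [Prod.mk_sub_mk, Prod.mk_sub_mk, Prod.norm_def, Prod.norm_def]
      exact max_le h1 (max_le h2 h3)
    have h6 := (G (x (k + 1), z (k + 1), w (k + 1)) - G (a, b, c)).le_opNorm u
    have h7 : ‖G (x (k + 1), z (k + 1), w (k + 1)) - G (a, b, c)‖ * ‖u‖
        ≤ K * ((1 + M) * δ) * ‖u‖ := by
      gcongr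
      exact h4.trans (by gcongr)
    have h8 := (abs_le.1 ((Real.norm_eq_abs _).symm.le.trans h6)).1
    rw [sub_apply] at h8
    linarith
  -- The direction is a sum of n block directions and one z-direction, hence the factor n + 1 in the
  -- constant.
  have hsplit : (y - x (k + 1), v - z (k + 1), (0 : EuclideanSpace ℝ (Fin nc))) =
      (∑ i, ((PiLp.single 2 i (y i - x (k + 1) i) : BlockVec d),
        (0 : EuclideanSpace ℝ (Fin nz)), (0 : EuclideanSpace ℝ (Fin nc))))
        + (0, v - z (k + 1), 0) := by
    have := sum_single (y - x (k + 1))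
    simp only [PiLp.sub_apply] at this
    ext1
    · simp [Prod.fst_sum, this]
    · ext1 <;> simp [Prod.snd_sum]
  have hz : -(K * ((1 + M) * δ) * ‖v - z (k + 1)‖) ≤
      G (x (k + 1), z (k + 1), w (k + 1)) (0, v - z (k + 1), 0) := by
    have := key (x (k + 1)) (z (k + 1)) (w k) ((hb (k + 1)).1.trans (by linarith))
      (hb (k + 1)).2.1 (hb k).2.2 (by simp; linarith) (by simp; linarith) hw
      (0, v - z (k + 1), 0) (S.fderiv_z_eq_zero k _).ge
    simpa [Prod.norm_def] using this
  have hx : ∀ i : Fin n, -(K * ((1 + M) * δ) * ‖y - x (k + 1)‖) ≤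
      G (x (k + 1), z (k + 1), w (k + 1)) (PiLp.single 2 i (y i - x (k + 1) i), 0, 0) := by
    intro i
    have hT := norm_sub_partialSweep_le (x k) (x (k + 1)) (i + 1)
    have hT' : ‖partialSweep (x k) (x (k + 1)) (i + 1)‖ ≤ 3 * r := by
      have := norm_le_norm_add_norm_sub (x (k + 1)) (partialSweep (x k) (x (k + 1)) (i + 1))
      linarith [(hb (k + 1)).1]
    have := key _ (z k) (w k) hT' (hb k).2.1 (hb k).2.2 (by linarith) (by linarith) hw
      (PiLp.single 2 i (y i - x (k + 1) i), 0, 0) (S.fderiv_block_nonneg k i (hy i))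
    have hn : ‖((PiLp.single 2 i (y i - x (k + 1) i) : BlockVec d),
        (0 : EuclideanSpace ℝ (Fin nz)), (0 : EuclideanSpace ℝ (Fin nc)))‖ ≤ ‖y - x (k + 1)‖ := by
      have := PiLp.norm_apply_le (y - x (k + 1)) i
      simpa [Prod.norm_def] using this
    have : K * ((1 + M) * δ) * ‖((PiLp.single 2 i (y i - x (k + 1) i) : BlockVec d),
        (0 : EuclideanSpace ℝ (Fin nz)), (0 : EuclideanSpace ℝ (Fin nc)))‖
        ≤ K * ((1 + M) * δ) * ‖y - x (k + 1)‖ := by gcongr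
    linarith
  rw [hsplit, map_add, map_sum]
  have hsum := Finset.sum_le_sum fun i (_ : i ∈ Finset.univ) => hx i
  rw [Finset.sum_const, Finset.card_univ, Fintype.card_fin, nsmul_eq_mul] at hsum
  have e1 : 0 ≤ K * ((1 + M) * δ) * ‖y - x (k + 1)‖ := by positivity
  have e2 : 0 ≤ n * (K * ((1 + M) * δ) * ‖v - z (k + 1)‖) := by positivity
  linarith

/-- At every iterate the augmented Lagrangian satisfies a quadratic lower bound, up to an error
which is proportional to the last decrease. -/
theorem exists_smoothLag_ge (S : AdmmSetting P μf μφ Lφ ρ xf zφ x z w)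
    (hW : ∀ k, √nc * ‖w k‖ * P.normC ≤ μf / 6) :
    ∃ K : ℝ, 0 < K ∧ ∀ (k : ℕ) (y : BlockVec d) (v : EuclideanSpace ℝ (Fin nz)),
      (∀ i, y i ∈ P.X i) →
      P.smoothLag ρ (x (k + 1), z (k + 1), w (k + 1))
        + (μf / 8 * ‖y - x (k + 1)‖ ^ 2 + μφ / 4 * ‖v - z (k + 1)‖ ^ 2)
      ≤ P.smoothLag ρ (y, v, w (k + 1)) + K * (P.smoothLag ρ (x k, z k, w k)
        - P.smoothLag ρ (x (k + 1), z (k + 1), w (k + 1))) := by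
  have hf := S.μf_pos
  have hφ := S.μφ_pos
  obtain ⟨K, hK0, hK⟩ := S.exists_fderiv_ge
  set c := K ^ 2 * (2 / μf + 1 / μφ) with hc
  have hc0 : 0 ≤ c := by positivity
  refine ⟨2 * c * (2 / μf + 4 / μφ) + 1, by positivity, fun k y v hy => ?_⟩
  have hconv := P.smoothLag_add_ge S.ρ_pos.le S.contDiff_f S.contDiff_φ S.f_convex S.φ_convex
    (x (k + 1)) (y - x (k + 1)) (z (k + 1)) (v - z (k + 1)) (w (k + 1))
  rw [add_sub_cancel, add_sub_cancel] at hconv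
  have hvi := hK k y v hy
  set a := ‖y - x (k + 1)‖
  set b := ‖v - z (k + 1)‖
  set p := ‖x (k + 1) - x k‖
  set q := ‖z (k + 1) - z k‖
  -- Here w + ρR = 2wᵏ⁺¹ - wᵏ, so three copies of the bound μ_f/6 give μ_f/2, halved by the
  -- prefactor. Half of the strong convexity of f remains.
  have hquad : -(μf / 4 * a ^ 2) ≤ 1 / 2 * inner ℝ
      (w (k + 1) + ρ • P.residual (x (k + 1)) (z (k + 1))) (P.quad (y - x (k + 1))) := by
    have e : w (k + 1) + ρ • P.residual (x (k + 1)) (z (k + 1)) =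
        w (k + 1) + (w (k + 1) - w k) := by rw [S.admm.w_step k, add_sub_cancel_left]
    have h1 := (abs_le.1 (P.abs_inner_quad_le
      (w (k + 1) + ρ • P.residual (x (k + 1)) (z (k + 1))) (y - x (k + 1)))).1
    have h2 : ‖w (k + 1) + ρ • P.residual (x (k + 1)) (z (k + 1))‖ ≤ 2 * ‖w (k + 1)‖ + ‖w k‖ := by
      rw [e]
      linarith [norm_add_le (w (k + 1)) (w (k + 1) - w k), norm_sub_le (w (k + 1)) (w k)]
    have h3 : √nc * ‖w (k + 1) + ρ • P.residual (x (k + 1)) (z (k + 1))‖ * P.normC * a ^ 2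
        ≤ √nc * (2 * ‖w (k + 1)‖ + ‖w k‖) * P.normC * a ^ 2 := by
      have := P.normC_nonneg
      gcongr
    have h4 : √nc * (2 * ‖w (k + 1)‖ + ‖w k‖) * P.normC ≤ μf / 2 := by
      linarith [hW k, hW (k + 1)]
    have h5 := mul_le_mul_of_nonneg_right h4 (sq_nonneg a)
    linarith
  have hd := S.descent k
  set L0 := P.smoothLag ρ (x k, z k, w k)
  set L1 := P.smoothLag ρ (x (k + 1), z (k + 1), w (k + 1))
  have hstep : p ^ 2 + q ^ 2 ≤ (2 / μf + 4 / μφ) * (L0 - L1) := by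
    have h1 : 0 ≤ μf / 2 * p ^ 2 := by positivity
    have h2 : 0 ≤ μφ / 4 * q ^ 2 := by positivity
    have h3 : 2 / μf * (μf / 2 * p ^ 2) ≤ 2 / μf * (L0 - L1) := by gcongr; linarith
    have h4 : 4 / μφ * (μφ / 4 * q ^ 2) ≤ 4 / μφ * (L0 - L1) := by gcongr; linarith
    have e3 : 2 / μf * (μf / 2 * p ^ 2) = p ^ 2 := by field_simp
    have e4 : 4 / μφ * (μφ / 4 * q ^ 2) = q ^ 2 := by field_simp
    linarith
  have hL : 0 ≤ L0 - L1 := by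
    have : 0 ≤ μf / 2 * p ^ 2 + μφ / 4 * q ^ 2 := by positivity
    linarith
  -- Young's inequality spends μ_f/8 of the remaining μ_f/4 and μ_φ/4 of μ_φ/2; the rest is a
  -- squared step, paid for by the decrease of L.
  have hyoung : K * (p + q) * (a + b) ≤ μf / 8 * a ^ 2 + μφ / 4 * b ^ 2 + c * (p + q) ^ 2 := by
    have h1 : 0 ≤ 2 / μf * (μf / 4 * a - K * (p + q)) ^ 2 := by positivity
    have h2 : 0 ≤ 1 / μφ * (μφ / 2 * b - K * (p + q)) ^ 2 := by positivity
    have e1 : 2 / μf * (μf / 4 * a - K * (p + q)) ^ 2 =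
        μf / 8 * a ^ 2 - K * (p + q) * a + 2 / μf * K ^ 2 * (p + q) ^ 2 := by
      field_simp; ring
    have e2 : 1 / μφ * (μφ / 2 * b - K * (p + q)) ^ 2 =
        μφ / 4 * b ^ 2 - K * (p + q) * b + 1 / μφ * K ^ 2 * (p + q) ^ 2 := by
      field_simp; ring
    rw [e1] at h1
    rw [e2] at h2
    rw [hc]
    linarith
  have hpq : c * (p + q) ^ 2 ≤ c * (2 * ((2 / μf + 4 / μφ) * (L0 - L1))) := by
    gcongr
    nlinarith [sq_nonneg (p - q)]
  linarith

end AdmmSetting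
end QuadConstrainedProblem

/-! ### From the smallness condition to small multipliers -/

/-- Clearing the denominator removes the convention a/0 = ∞: for b = 0 the product form is trivially
true. -/
theorem ENNReal.mul_le_of_ofReal_le {C κ p a b s : ℝ} {m : ENNReal} (hκ : 0 ≤ κ) (hp : 0 < p)
    (ha : 0 ≤ a) (hb : 0 ≤ b) (hs : 0 ≤ s)
    (hm : m ≤ ENNReal.ofReal a / ENNReal.ofReal b * ENNReal.ofReal s)
    (h : ENNReal.ofReal C ≤ ENNReal.ofReal κ * ((ENNReal.ofReal p)⁻¹ * m)) :
    C * p * b ≤ κ * a * s := by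
  rcases hb.eq_or_lt with rfl | hb
  · simp only [mul_zero]; positivity
  have h1 : ENNReal.ofReal C ≤ ENNReal.ofReal (κ * (p⁻¹ * (a / b * s))) := by
    rw [ENNReal.ofReal_mul hκ, ENNReal.ofReal_mul (by positivity), ENNReal.ofReal_inv_of_pos hp,
      ENNReal.ofReal_mul (by positivity), ENNReal.ofReal_div_of_pos hb]
    exact h.trans (by gcongr)
  rw [ENNReal.ofReal_le_ofReal_iff (by positivity)] at h1
  calc C * p * b ≤ κ * (p⁻¹ * (a / b * s)) * p * b := by gcongr
    _ = κ * a * s := by field_simp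

theorem ENNReal.sq_mul_le_of_ofReal_le {C κ p a b s t : ℝ} {m : ENNReal} (hC : 0 ≤ C)
    (hκ : 0 ≤ κ) (hp : 0 < p) (ha : 0 ≤ a) (hb : 0 ≤ b) (hs : 0 ≤ s) (ht : 0 ≤ t)
    (hm : m ≤ (ENNReal.ofReal a / ENNReal.ofReal b) ^ (1 / 2 : ℝ) * ENNReal.ofReal s
      * ENNReal.ofReal t)
    (h : ENNReal.ofReal C ≤ ENNReal.ofReal κ * ((ENNReal.ofReal p)⁻¹ * m)) :
    (C * p) ^ 2 * b ≤ κ ^ 2 * a * (s * t) ^ 2 := by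
  rcases hb.eq_or_lt with rfl | hb
  · simp only [mul_zero]; positivity
  have h1 : m ≤ ENNReal.ofReal (√(a / b)) / ENNReal.ofReal 1 * ENNReal.ofReal (s * t) := by
    rw [ENNReal.ofReal_one, div_one, ENNReal.ofReal_mul hs, ← mul_assoc, Real.sqrt_eq_rpow,
      ← ENNReal.ofReal_rpow_of_nonneg (by positivity) (by norm_num), ENNReal.ofReal_div_of_pos hb]
    exact hm
  have h2 := ENNReal.mul_le_of_ofReal_le hκ hp (Real.sqrt_nonneg _) zero_le_one
    (mul_nonneg hs ht) h1 h
  rw [mul_one] at h2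
  calc (C * p) ^ 2 * b ≤ (κ * √(a / b) * (s * t)) ^ 2 * b := by gcongr
    _ = κ ^ 2 * (√(a / b) ^ 2 * b) * (s * t) ^ 2 := by ring
    _ = κ ^ 2 * a * (s * t) ^ 2 := by
      rw [Real.sq_sqrt (by positivity), div_mul_cancel₀ _ hb.ne']

namespace QuadConstrainedProblem

variable {n : ℕ} {d : Fin n → ℕ} {nc nz : ℕ}

namespace AdmmSetting

variable {P : QuadConstrainedProblem d nc nz} {μf μφ Lφ ρ : ℝ} {xf : BlockVec d}
    {zφ : EuclideanSpace ℝ (Fin nz)} {x : ℕ → BlockVec d} {z : ℕ → EuclideanSpace ℝ (Fin nz)}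
    {w : ℕ → EuclideanSpace ℝ (Fin nc)}

/-- Because ∇φ(z⁰) lies in the range of Qᵀ, z⁰ minimizes φ on {Qz = -A(x⁰)}. Compare it with the
solution given by the pseudoinverse, whose norm is controlled. -/
theorem φ_zero_sub_le (S : AdmmSetting P μf μφ Lφ ρ xf zφ x z w) :
    P.φ (z 0) - P.φ zφ ≤ Lφ * (P.normPinv * ‖P.A (x 0)‖ + ‖zφ‖) ^ 2 := by
  set B := ((P.Q * P.Q.transpose)⁻¹ * P.Q).transpose
  set v := B.mulE (-P.A (x 0)) with hv
  have hQv : P.Q.mulE v = -P.A (x 0) := Matrix.mulE_pinv_transpose S.rank _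
  have hQz : P.Q.mulE (z 0) = -P.A (x 0) := by
    have := S.residual_zero
    rw [residual_eq] at this
    exact eq_neg_of_add_eq_zero_right this
  have hd := S.contDiff_φ.differentiable two_ne_zero
  have h1 := S.φ_convex.add_fderiv_add_le (hd (z 0)).hasFDerivAt (v - z 0)
  have h2 : fderiv ℝ P.φ (z 0) (v - z 0) = 0 := by
    rw [fderiv_apply_eq_inner_gradient, ← neg_neg (gradient P.φ (z 0)), ← S.dual_eq 0,
      inner_neg_left, real_inner_comm, ← Matrix.inner_mulE, map_sub, hQv, hQz, sub_self,
      inner_zero_left, neg_zero]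
  rw [h2, add_sub_cancel] at h1
  have h3 := S.φ_convex.sub_le_mul_norm_sq S.μφ_pos.le (hd v) S.zφ_min (S.φ_smooth v zφ)
  have h4 : ‖v‖ ≤ P.normPinv * ‖P.A (x 0)‖ := by
    have := B.norm_mulE_apply_le (-P.A (x 0))
    rwa [Matrix.spectralNorm₂_transpose, norm_neg] at this
  have h5 : ‖v - zφ‖ ≤ P.normPinv * ‖P.A (x 0)‖ + ‖zφ‖ := (norm_sub_le _ _).trans (by linarith)
  have h6 : Lφ * ‖v - zφ‖ ^ 2 ≤ Lφ * (P.normPinv * ‖P.A (x 0)‖ + ‖zφ‖) ^ 2 := by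
    have := S.Lφ_pos
    gcongr
  have h7 : 0 ≤ μφ / 2 * ‖v - z 0‖ ^ 2 := by
    have := S.μφ_pos
    positivity
  linarith

/-- Square root of `dist_sq_le`: a sum of squares of nonnegative terms is at most the square of
their sum, and 8/3 ≤ 2². -/
theorem norm_z_sub_le (S : AdmmSetting P μf μφ Lφ ρ xf zφ x z w) {Lf : ℝ} (hLf : 0 < Lf)
    (hgrad : ‖gradient P.f (x 0) - gradient P.f xf‖ ≤ Lf * ‖x 0 - xf‖) (k : ℕ) :
    √μφ * ‖z k - zφ‖ ≤ 2 * (√Lf * (‖xf‖ + ‖x 0‖) + √Lφ * ‖zφ‖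
      + √Lφ * (P.normPinv * ‖P.A (x 0)‖)) := by
  have hφ := S.μφ_pos
  have hL := S.Lφ_pos
  have hp : 0 ≤ P.normPinv := Matrix.spectralNorm₂_nonneg _
  refine le_of_sq_le_sq ?_ (by positivity)
  rw [mul_pow, Real.sq_sqrt hφ.le, mul_pow]
  have h1 := S.dist_sq_le k
  have h2 := S.f_convex.sub_le_mul_norm_sq S.μf_pos.le
    (S.contDiff_f.differentiable two_ne_zero (x 0)) S.xf_min hgrad
  have h3 := S.φ_zero_sub_le
  have h4 : Lf * ‖x 0 - xf‖ ^ 2 ≤ (√Lf * (‖xf‖ + ‖x 0‖)) ^ 2 := by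
    rw [mul_pow, Real.sq_sqrt hLf.le]
    gcongr
    linarith [norm_sub_le (x 0) xf]
  have h5 : Lφ * (P.normPinv * ‖P.A (x 0)‖ + ‖zφ‖) ^ 2 =
      (√Lφ * ‖zφ‖ + √Lφ * (P.normPinv * ‖P.A (x 0)‖)) ^ 2 := by
    rw [← mul_add, mul_pow, Real.sq_sqrt hL.le, add_comm]
  have h6 : 0 ≤ μf / 2 * ‖x k - xf‖ ^ 2 := by
    have := S.μf_pos
    positivity
  have h7 : 0 ≤ √Lf * (‖xf‖ + ‖x 0‖) := by positivity
  have h8 : 0 ≤ √Lφ * ‖zφ‖ + √Lφ * (P.normPinv * ‖P.A (x 0)‖) := by positivity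
  rw [h5] at h3
  have h9 := mul_nonneg h7 h8
  nlinarith

/-- ‖wᵏ‖ is at most a multiple of ‖zᵏ - z_φ‖, whose bound splits into three parts once ‖A(x⁰)‖ is
expanded: data of the minimizers, affine part of A, quadratic part. These are controlled by m₁, m₂
and m₃ respectively. With κ = 1/36 they add up to 2(κ + κ + κ²)μ_f ≤ μ_f/6. -/
theorem small_dual (S : AdmmSetting P μf μφ Lφ ρ xf zφ x z w) {Lf : ℝ} (hLf : 0 < Lf)
    (hgrad : ‖gradient P.f (x 0) - gradient P.f xf‖ ≤ Lf * ‖x 0 - xf‖)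
    (hQ : P.QCondition (1 / 36) Lf μf Lφ μφ (x 0) xf zφ) (k : ℕ) :
    √nc * ‖w k‖ * P.normC ≤ μf / 6 := by
  have hf := S.μf_pos
  have hφ := S.μφ_pos
  have hL := S.Lφ_pos
  rcases Nat.eq_zero_or_pos nc with h0 | hc
  · subst h0
    simp only [Nat.cast_zero, Real.sqrt_zero, zero_mul]
    positivity
  have hp : 0 < P.normPinv := Matrix.spectralNorm₂_pinv_pos S.rank hc
  have hl : 0 < P.lamQ := Matrix.lambdaMin_pos (Matrix.posDef_mul_transpose_of_rank_eq S.rank) hc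
  have hlp : √P.lamQ * P.normPinv ≤ 1 :=
    Matrix.sqrt_lambdaMin_mul_spectralNorm₂_pinv_le S.rank hc
  have hC := P.normC_nonneg
  have hlin := P.normLin_nonneg
  have hconst := P.normConst_nonneg
  have hs : √(Lφ ^ 3 * (nc : ℝ) ^ 2) = Lφ * √Lφ * nc := by
    rw [Real.sqrt_mul' _ (sq_nonneg _), Real.sqrt_sq (Nat.cast_nonneg _), pow_succ,
      Real.sqrt_mul' _ hL.le, Real.sqrt_sq hL.le]
  have t1 := ENNReal.mul_le_of_ofReal_le (a := μf * √μφ) (s := 1)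
    (b := √nc * Lφ * (√Lf * (‖xf‖ + ‖x 0‖) + √Lφ * ‖zφ‖)) (by norm_num) hp (by positivity)
    (by positivity) zero_le_one (by
      rw [ENNReal.ofReal_one, mul_one]
      exact min_le_left _ _) hQ
  have t2 := ENNReal.mul_le_of_ofReal_le (by norm_num) hp (by positivity)
    (by positivity) (by positivity) ((min_le_right _ _).trans (min_le_left _ _)) hQ
  have t3 := ENNReal.sq_mul_le_of_ofReal_le hC (by norm_num) hp (by positivity)
    (by positivity) (by positivity) (by positivity)
    ((min_le_right _ _).trans (min_le_right _ _)) hQ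
  rw [hs] at t2 t3
  rw [← Real.sqrt_eq_rpow] at t2
  -- The square is √λ_min · ‖(QQᵀ)⁻¹Q‖, which is at most 1.
  have hst : (P.lamQ ^ (1 / 4 : ℝ) * P.normPinv ^ (1 / 2 : ℝ)) ^ 2 ≤ 1 := by
    rw [mul_pow, ← Real.sqrt_eq_rpow P.normPinv, Real.sq_sqrt hp.le, ← Real.rpow_natCast,
      ← Real.rpow_mul hl.le]
    norm_num
    rwa [← Real.sqrt_eq_rpow]
  have hz := S.norm_z_sub_le hLf hgrad k
  have hA := P.norm_A_le (x 0)
  have hw := S.norm_dual_le' k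
  set a := μf * √μφ with ha
  have ha0 : 0 ≤ a := by positivity
  set C := P.normC
  set p := P.normPinv
  set E := ‖x 0‖ * P.normLin + P.normConst with hE
  have u2 : C * p * (Lφ * √Lφ * nc * E) * p ≤ 1 / 36 * a := by
    have h1 := mul_le_mul_of_nonneg_right t2 hp.le
    have h2 : 1 / 36 * a * (√P.lamQ * p) ≤ 1 / 36 * a * 1 := by gcongr
    linarith
  have u3 : (C * p) ^ 2 * (Lφ * √Lφ * nc * ‖x 0‖ ^ 2) ≤ (1 / 36) ^ 2 * a := by
    have h2 : (1 / 36) ^ 2 * a * (P.lamQ ^ (1 / 4 : ℝ) * p ^ (1 / 2 : ℝ)) ^ 2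
      ≤ (1 / 36) ^ 2 * a * 1 := by gcongr
    linarith
  have hφ' : 0 < √μφ := Real.sqrt_pos.2 hφ
  refine le_of_mul_le_mul_left ?_ hφ'
  have hnc : √(nc : ℝ) * √nc = nc := Real.mul_self_sqrt (Nat.cast_nonneg _)
  calc √μφ * (√nc * ‖w k‖ * C) ≤ √μφ * (√nc * (p * (Lφ * ‖z k - zφ‖)) * C) := by gcongr
    _ = √nc * p * Lφ * C * (√μφ * ‖z k - zφ‖) := by ring
    _ ≤ √nc * p * Lφ * C * (2 * (√Lf * (‖xf‖ + ‖x 0‖) + √Lφ * ‖zφ‖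
      + √Lφ * (p * (√nc * (C * ‖x 0‖ ^ 2 + E))))) := 
        mul_le_mul_of_nonneg_left (hz.trans (by gcongr)) (by positivity)
    _ = 2 * (C * p * (√nc * Lφ * (√Lf * (‖xf‖ + ‖x 0‖) + √Lφ * ‖zφ‖))
      + (C * p) ^ 2 * (Lφ * √Lφ * (√nc * √nc) * ‖x 0‖ ^ 2)
      + C * p * (Lφ * √Lφ * (√nc * √nc) * E) * p) := by ring
    _ ≤ √μφ * (μf / 6) := by
      rw [hnc]
      linarith

end AdmmSetting
end QuadConstrainedProblem

/-! ### Limit point, linear rate and optimality -/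

theorem tendsto_of_quadratic_bound {E : Type*} [NormedAddCommGroup E] {u : ℕ → E} {a : E} {c : ℝ}
    (hc : 0 < c) {e : ℕ → ℝ} (he : Tendsto e atTop (𝓝 0))
    (h : ∀ k, c * ‖a - u (k + 1)‖ ^ 2 ≤ e k) : Tendsto u atTop (𝓝 a) := by
  rw [← tendsto_add_atTop_iff_nat 1, tendsto_iff_norm_sub_tendsto_zero]
  have h1 : Tendsto (fun k => √(c⁻¹ * e k)) atTop (𝓝 0) := by
    simpa using (he.const_mul c⁻¹).sqrt
  refine squeeze_zero (fun _ => norm_nonneg _) (fun k => Real.le_sqrt_of_sq_le ?_) h1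
  rw [norm_sub_rev, ← div_eq_inv_mul, le_div_iff₀' hc]
  exact h k

namespace QuadConstrainedProblem

variable {n : ℕ} {d : Fin n → ℕ} {nc nz : ℕ}

theorem smoothLag_of_residual_eq_zero (P : QuadConstrainedProblem d nc nz) (ρ : ℝ)
    {y : BlockVec d} {v : EuclideanSpace ℝ (Fin nz)} (h : P.residual y v = 0)
    (w : EuclideanSpace ℝ (Fin nc)) : P.smoothLag ρ (y, v, w) = P.f y + P.φ v := by
  simp [smoothLag, h]

theorem isCompact_pairBall (x : BlockVec d) (z : EuclideanSpace ℝ (Fin nz)) (r : ℝ) :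
    IsCompact (pairBall x z r) := by
  refine Metric.isCompact_of_isClosed_isBounded ?_ ?_
  · exact isClosed_le (by fun_prop) continuous_const
  · refine Bornology.IsBounded.subset (Metric.isBounded_closedBall (x := (x, z)) (r := |r|))
      fun p hp => ?_
    have hp' : ‖p.1 - x‖ ^ 2 + ‖p.2 - z‖ ^ 2 ≤ r ^ 2 := hp
    rw [mem_closedBall_iff_norm, Prod.norm_def]
    refine max_le ?_ ?_ <;> refine le_of_sq_le_sq ?_ (abs_nonneg r) <;> rw [sq_abs]
    · simpa using by linarith [sq_nonneg ‖p.2 - z‖]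
    · simpa using by linarith [sq_nonneg ‖p.1 - x‖]

theorem isClosed_mem_blocks (P : QuadConstrainedProblem d nc nz)
    (hX : ∀ i, IsPolyhedralSet (P.X i)) : IsClosed {y : BlockVec d | ∀ i, y i ∈ P.X i} := by
  rw [Set.ofPred_forall]
  exact isClosed_iInter fun i =>
    (hX i).isClosed.preimage (PiLp.continuous_apply 2 (fun i => EuclideanSpace ℝ (Fin (d i))) i)

/-- The minimum of the augmented Lagrangian over a ball around a feasible point is attained. -/
theorem exists_isLeast_lagrangian (P : QuadConstrainedProblem d nc nz) (ρ : ℝ)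
    (hX : ∀ i, IsPolyhedralSet (P.X i)) (hf : ContDiff ℝ 2 P.f) (hφ : ContDiff ℝ 2 P.φ)
    {x : BlockVec d} (hx : ∀ i, x i ∈ P.X i) (z : EuclideanSpace ℝ (Fin nz))
    (w : EuclideanSpace ℝ (Fin nc)) (r : ℝ) :
    ∃ (y : BlockVec d) (v : EuclideanSpace ℝ (Fin nz)), (∀ i, y i ∈ P.X i) ∧
      IsLeast ((fun p => P.lagrangian ρ p.1 p.2 w) '' pairBall x z r)
        (P.smoothLag ρ (y, v, w) : EReal) := by
  have hcpt : IsCompact (pairBall x z r ∩ Prod.fst ⁻¹' {y : BlockVec d | ∀ i, y i ∈ P.X i}) :=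
    (isCompact_pairBall x z r).inter_right ((P.isClosed_mem_blocks hX).preimage continuous_fst)
  have hne : (x, z) ∈ pairBall x z r ∩ Prod.fst ⁻¹' {y : BlockVec d | ∀ i, y i ∈ P.X i} :=
    ⟨by simpa [pairBall] using sq_nonneg r, hx⟩
  have hcont : Continuous fun p : BlockVec d × EuclideanSpace ℝ (Fin nz) =>
      P.smoothLag ρ (p.1, p.2, w) :=
    (P.contDiff_smoothLag ρ hf hφ).continuous.comp (by fun_prop)
  obtain ⟨⟨y, v⟩, ⟨hp, hy⟩, hmin⟩ := hcpt.exists_isMinOn ⟨_, hne⟩ hcont.continuousOn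
  refine ⟨y, v, hy, ⟨(y, v), hp, P.lagrangian_of_mem ρ hy v w⟩, ?_⟩
  rintro _ ⟨⟨y', v'⟩, hp', rfl⟩
  by_cases h : ∀ i, y' i ∈ P.X i
  · simp only [P.lagrangian_of_mem ρ h, EReal.coe_le_coe_iff]
    exact isMinOn_iff.1 hmin (y', v') ⟨hp', h⟩
  · simp only [P.lagrangian_of_not_mem ρ h, le_top]

namespace AdmmSetting

variable {P : QuadConstrainedProblem d nc nz} {μf μφ Lφ ρ : ℝ} {xf : BlockVec d}
    {zφ : EuclideanSpace ℝ (Fin nz)} {x : ℕ → BlockVec d} {z : ℕ → EuclideanSpace ℝ (Fin nz)}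
    {w : ℕ → EuclideanSpace ℝ (Fin nc)}

theorem exists_tendsto_smoothLag (S : AdmmSetting P μf μφ Lφ ρ xf zφ x z w) :
    ∃ ℓ, Tendsto (fun k => P.smoothLag ρ (x k, z k, w k)) atTop (𝓝 ℓ) := by
  refine ⟨_, tendsto_atTop_ciInf S.antitone_smoothLag ⟨P.f xf + P.φ zφ, ?_⟩⟩
  rintro _ ⟨k, rfl⟩
  have h1 := S.smoothLag_ge k
  have hf := S.μf_pos
  have hφ := S.μφ_pos
  have : 0 ≤ μf / 2 * ‖x k - xf‖ ^ 2 + 3 / 8 * μφ * ‖z k - zφ‖ ^ 2 := by positivity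
  simp only
  linarith

/-- ρR is the last multiplier step, controlled by the last z-step, whose square is controlled by the
vanishing decrease of L. -/
theorem tendsto_residual (S : AdmmSetting P μf μφ Lφ ρ xf zφ x z w) :
    Tendsto (fun k => P.residual (x k) (z k)) atTop (𝓝 0) := by
  have hf := S.μf_pos
  have hφ := S.μφ_pos
  obtain ⟨ℓ, hℓ⟩ := S.exists_tendsto_smoothLag
  have h1 := hℓ.sub (hℓ.comp (tendsto_add_atTop_nat 1))
  rw [sub_self] at h1
  have h2 : Tendsto (fun k => ‖z (k + 1) - z k‖ ^ 2) atTop (𝓝 0) := by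
    refine squeeze_zero (fun k => sq_nonneg _) (fun k => ?_)
      (by simpa using h1.const_mul (4 / μφ))
    have h3 := S.descent k
    have h4 : 0 ≤ μf / 2 * ‖x (k + 1) - x k‖ ^ 2 := by positivity
    rw [← div_le_iff₀' (by positivity), div_div_eq_mul_div]
    linarith
  have h3 : Tendsto (fun k => ‖z (k + 1) - z k‖) atTop (𝓝 0) := by
    have := h2.sqrt
    simpa [Real.sqrt_sq] using this
  rw [← tendsto_add_atTop_iff_nat 1]
  refine squeeze_zero_norm (fun k => ?_)
    (by simpa using h3.const_mul (ρ⁻¹ * (P.normPinv * Lφ)))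
  have h4 : P.residual (x (k + 1)) (z (k + 1)) = ρ⁻¹ • (w (k + 1) - w k) := by
    rw [S.admm.w_step k, add_sub_cancel_left, smul_smul, inv_mul_cancel₀ S.ρ_pos.ne', one_smul]
  have hρ := S.ρ_pos
  rw [h4, norm_smul, norm_inv, Real.norm_of_nonneg hρ.le, mul_assoc, mul_assoc]
  gcongr
  exact S.norm_dual_sub_le (k + 1) k

/-- A cluster point of the iterates is feasible, and the augmented Lagrangian converges to the
value of the objective there. -/
theorem exists_feasible_limit (S : AdmmSetting P μf μφ Lφ ρ xf zφ x z w) :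
    ∃ (xs : BlockVec d) (zs : EuclideanSpace ℝ (Fin nz)), (∀ i, xs i ∈ P.X i) ∧
      P.residual xs zs = 0 ∧
      Tendsto (fun k => P.smoothLag ρ (x k, z k, w k)) atTop (𝓝 (P.f xs + P.φ zs)) := by
  obtain ⟨r, hr, hb⟩ := S.exists_norm_bound
  have hmem : ∀ k, (x k, z k, w k) ∈ Metric.closedBall
      (0 : BlockVec d × EuclideanSpace ℝ (Fin nz) × EuclideanSpace ℝ (Fin nc)) r := fun k => by
    rw [mem_closedBall_zero_iff, Prod.norm_def, Prod.norm_def]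
    exact max_le (hb k).1 (max_le (hb k).2.1 (hb k).2.2)
  obtain ⟨⟨xs, zs, ws⟩, -, θ, hθ, hlim⟩ :=
    (isCompact_closedBall _ r).tendsto_subseq hmem
  have hx : Tendsto (fun k => x (θ k)) atTop (𝓝 xs) := (Prod.tendsto_iff _ _).1 hlim |>.1
  have hz : Tendsto (fun k => z (θ k)) atTop (𝓝 zs) :=
    (Prod.tendsto_iff _ _).1 ((Prod.tendsto_iff _ _).1 hlim).2 |>.1
  have hres : P.residual xs zs = 0 := by
    have hA := P.contDiff_A.continuous
    have h1 : Tendsto (fun k => P.residual (x (θ k)) (z (θ k))) atTop (𝓝 (P.residual xs zs)) :=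
      ((hA.tendsto xs).comp hx).add ((P.Q.mulE.continuous.tendsto zs).comp hz)
    exact tendsto_nhds_unique h1 (S.tendsto_residual.comp hθ.tendsto_atTop)
  refine ⟨xs, zs, (P.isClosed_mem_blocks S.polyhedral).mem_of_tendsto hx
    (Eventually.of_forall fun k => S.mem (θ k)), hres, ?_⟩
  obtain ⟨ℓ, hℓ⟩ := S.exists_tendsto_smoothLag
  have h2 : Tendsto (fun k => P.smoothLag ρ (x (θ k), z (θ k), w (θ k))) atTop
      (𝓝 (P.smoothLag ρ (xs, zs, ws))) :=
    ((P.contDiff_smoothLag ρ S.contDiff_f S.contDiff_φ).continuous.tendsto _).comp hlim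
  have h3 := tendsto_nhds_unique h2 (hℓ.comp hθ.tendsto_atTop)
  rwa [← P.smoothLag_of_residual_eq_zero ρ hres ws, h3]

/-- Convergence of ADMM when the multipliers are small compared with the quadratic part. -/
theorem convergence (S : AdmmSetting P μf μφ Lφ ρ xf zφ x z w)
    (hW : ∀ k, √nc * ‖w k‖ * P.normC ≤ μf / 6) :
    (∃ r c₂ : ℝ, 0 < r ∧ 1 < c₂ ∧
      ∃ lag lmin : ℕ → ℝ,
        (∀ k, P.lagrangian ρ (x k) (z k) (w k) = (lag k : EReal)) ∧
        (∀ k, IsLeast ((fun p => P.lagrangian ρ p.1 p.2 (w k)) '' pairBall (x k) (z k) r)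
          (lmin k : EReal)) ∧
        (fun k => lag k - lmin k) =O[atTop] (fun k : ℕ => c₂ ^ (-(k : ℤ)))) ∧
    ∃ (xs : BlockVec d) (zs : EuclideanSpace ℝ (Fin nz)),
      Tendsto x atTop (𝓝 xs) ∧ Tendsto z atTop (𝓝 zs) ∧ P.IsLocalMinimum xs zs := by
  have hf := S.μf_pos
  have hφ := S.μφ_pos
  obtain ⟨K, hK0, hK⟩ := S.exists_smoothLag_ge hW
  obtain ⟨xs, zs, hxs, hres, hlim⟩ := S.exists_feasible_limit
  set lag : ℕ → ℝ := fun k => P.smoothLag ρ (x k, z k, w k) with hlag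
  set ℓ := P.f xs + P.φ zs with hℓ
  have hle : ∀ k, ℓ ≤ lag k := fun k => S.antitone_smoothLag.le_of_tendsto hlim k
  -- At a feasible point the value of L is ℓ for every multiplier, so one reference value serves all
  -- k.
  have hstep : ∀ k, lag (k + 1) - ℓ
      + (μf / 8 * ‖xs - x (k + 1)‖ ^ 2 + μφ / 4 * ‖zs - z (k + 1)‖ ^ 2)
      ≤ K * (lag k - lag (k + 1)) := fun k => by
    have := hK k xs zs hxs
    rw [P.smoothLag_of_residual_eq_zero ρ hres] at this
    simp only [hlag]
    linarith
  have hdiff : Tendsto (fun k => K * (lag k - lag (k + 1))) atTop (𝓝 0) := by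
    simpa using (hlim.sub (hlim.comp (tendsto_add_atTop_nat 1))).const_mul K
  refine ⟨?_, xs, zs, ?_, ?_, hxs, hres, ?_⟩
  · choose y v hy hmin using fun k =>
      P.exists_isLeast_lagrangian ρ S.polyhedral S.contDiff_f S.contDiff_φ (S.mem k) (z k) (w k) 1
    -- The bound is global, so any radius would do. The rate comes from (1 + K)(Lᵏ⁺¹ - ℓ) ≤ K(Lᵏ -
    -- ℓ).
    refine ⟨1, (1 + K) / K, one_pos, (one_lt_div hK0).2 (by linarith), lag,
      fun k => P.smoothLag ρ (y k, v k, w k), fun k => P.lagrangian_of_mem ρ (S.mem k) _ _,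
      hmin, ?_⟩
    have hc : ((1 + K) / K)⁻¹ = K / (1 + K) := inv_div _ _
    have hgeo : ∀ k, lag k - ℓ ≤ (lag 0 - ℓ) * (K / (1 + K)) ^ k := fun k => by
      induction k with
      | zero => simp
      | succ k ih =>
        have h1 : lag (k + 1) - ℓ ≤ K / (1 + K) * (lag k - ℓ) := by
          rw [div_mul_eq_mul_div, le_div_iff₀ (by positivity)]
          have h2 := hstep k
          have h3 : 0 ≤ μf / 8 * ‖xs - x (k + 1)‖ ^ 2 + μφ / 4 * ‖zs - z (k + 1)‖ ^ 2 := by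
            positivity
          linarith
        calc _ ≤ _ := h1
          _ ≤ K / (1 + K) * ((lag 0 - ℓ) * (K / (1 + K)) ^ k) := by gcongr
          _ = _ := by ring
    refine Asymptotics.IsBigO.of_bound ((1 + K) * (lag 0 - ℓ)) ?_
    -- The gap at an iterate is bounded by the preceding decrease, so k = 0 is excluded; the index
    -- shift turns K into 1 + K in the constant.
    filter_upwards [eventually_ge_atTop 1] with k hk
    obtain ⟨k, rfl⟩ := Nat.exists_eq_succ_of_ne_zero (Nat.one_le_iff_ne_zero.1 hk)
    rw [zpow_neg, zpow_natCast, ← inv_pow, hc, Nat.succ_eq_add_one]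
    have h0 : 0 ≤ lag (k + 1) - P.smoothLag ρ (y (k + 1), v (k + 1), w (k + 1)) := by
      have := (hmin (k + 1)).2 ⟨(x (k + 1), z (k + 1)), by simp [pairBall], rfl⟩
      simp only [P.lagrangian_of_mem ρ (S.mem (k + 1)), EReal.coe_le_coe_iff] at this
      linarith
    rw [Real.norm_of_nonneg h0, Real.norm_of_nonneg (by positivity)]
    have h1 := hK k (y (k + 1)) (v (k + 1)) (hy (k + 1))
    have h2 : 0 ≤ μf / 8 * ‖y (k + 1) - x (k + 1)‖ ^ 2
        + μφ / 4 * ‖v (k + 1) - z (k + 1)‖ ^ 2 := by positivity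
    calc _ ≤ K * (lag k - lag (k + 1)) := by
          simp only [hlag]
          linarith
      _ ≤ K * (lag k - ℓ) := by
          gcongr
          exact hle (k + 1)
      _ ≤ K * ((lag 0 - ℓ) * (K / (1 + K)) ^ k) := by
          gcongr
          exact hgeo k
      _ = (1 + K) * (lag 0 - ℓ) * (K / (1 + K)) ^ (k + 1) := by
          rw [pow_succ]
          field_simp
  · refine tendsto_of_quadratic_bound (c := μf / 8) (by positivity) hdiff fun k => ?_
    have h1 := hstep k
    have h2 : 0 ≤ μφ / 4 * ‖zs - z (k + 1)‖ ^ 2 := by positivity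
    linarith [hle (k + 1)]
  · refine tendsto_of_quadratic_bound (c := μφ / 4) (by positivity) hdiff fun k => ?_
    have h1 := hstep k
    have h2 : 0 ≤ μf / 8 * ‖xs - x (k + 1)‖ ^ 2 := by positivity
    linarith [hle (k + 1)]
  -- The limit is a global minimum: let k → ∞ in the approximate minimality at any feasible (y, v).
  · refine IsMinOn.localize (isMinOn_iff.2 ?_)
    rintro ⟨y, v⟩ hyv
    have hyv' : P.residual y v = 0 := hyv
    by_cases hy : ∀ i, y i ∈ P.X i
    · simp only [P.F_of_mem hxs, P.F_of_mem hy, ← EReal.coe_add, EReal.coe_le_coe_iff]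
      refine le_of_tendsto_of_tendsto' (hlim.comp (tendsto_add_atTop_nat 1))
        (g := fun k => P.f y + P.φ v + K * (lag k - lag (k + 1)))
        (by simpa using hdiff.const_add (P.f y + P.φ v)) fun k => ?_
      have h1 := hK k y v hy
      rw [P.smoothLag_of_residual_eq_zero ρ hyv'] at h1
      have h2 : 0 ≤ μf / 8 * ‖y - x (k + 1)‖ ^ 2 + μφ / 4 * ‖v - z (k + 1)‖ ^ 2 := by
        positivity
      simp only [Function.comp, hlag]
      linarith
    · simp only [P.F_of_not_mem hy, EReal.top_add_coe, le_top]

end AdmmSetting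
end QuadConstrainedProblem

/-! ### The main theorem -/

theorem mainTheorem3 :
    ∃ κ : ℝ, 0 < κ ∧
      ∀ (n : ℕ) (d : Fin n → ℕ) (nc nz : ℕ) (P : QuadConstrainedProblem d nc nz)
        (μf μφ Lf Lφ ρ : ℝ) (xf : BlockVec d) (zφ : EuclideanSpace ℝ (Fin nz))
        (x : ℕ → BlockVec d) (z : ℕ → EuclideanSpace ℝ (Fin nz))
        (w : ℕ → EuclideanSpace ℝ (Fin nc)),
        P.IsMultiAffine →
        -- `f` and `φ` are `C²` and strongly convex, `xf` and `zφ` are their minimizers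
        ContDiff ℝ 2 P.f → 0 < μf → StrongConvexOn Set.univ μf P.f → IsMinOn P.f Set.univ xf →
        ContDiff ℝ 2 P.φ → 0 < μφ → StrongConvexOn Set.univ μφ P.φ → IsMinOn P.φ Set.univ zφ →
        -- `φ` is `Lφ`-smooth
        0 < Lφ → IsLSmooth Lφ P.φ →
        -- `Lf` is a Lipschitz constant of `∇f` between `xf` and the initial point
        0 < Lf →
        (∀ u ∈ segment ℝ xf (x 0), ∀ v ∈ segment ℝ xf (x 0),
          ‖gradient P.f u - gradient P.f v‖ ≤ Lf * ‖u - v‖) →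
        -- the constraint sets are polyhedral
        (∀ i, IsPolyhedralSet (P.X i)) →
        -- `Q` has full row rank
        P.Q.rank = nc →
        -- the penalty parameter
        0 < ρ →
        max (4 * Lφ ^ 2 / (μφ * lambdaMinPos (P.Q.transpose * P.Q)))
          (4 * Lφ ^ 2 / (μφ * √(lambdaMinPos (P.Q * P.Q.transpose)))) ≤ ρ →
        -- the iterates and their initialization
        P.IsADMM ρ x z w →
        (∀ i, x 0 i ∈ P.X i) →
        P.residual (x 0) (z 0) = 0 →
        WithLp.toLp 2 (P.Q.transpose.mulVec (WithLp.ofLp (w 0))) = -gradient P.φ (z 0) →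
        -- the degree of nonlinearity is small
        P.QCondition κ Lf μf Lφ μφ (x 0) xf zφ →
        (∃ r c₂ : ℝ, 0 < r ∧ 1 < c₂ ∧
          ∃ lag lmin : ℕ → ℝ,
            (∀ k, P.lagrangian ρ (x k) (z k) (w k) = (lag k : EReal)) ∧
            (∀ k, IsLeast ((fun p => P.lagrangian ρ p.1 p.2 (w k)) '' pairBall (x k) (z k) r)
              (lmin k : EReal)) ∧
            (fun k => lag k - lmin k) =O[atTop] (fun k : ℕ => c₂ ^ (-(k : ℤ)))) ∧
        ∃ (xs : BlockVec d) (zs : EuclideanSpace ℝ (Fin nz)),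
          Tendsto x atTop (𝓝 xs) ∧ Tendsto z atTop (𝓝 zs) ∧ P.IsLocalMinimum xs zs := by
  refine ⟨1 / 36, by norm_num, ?_⟩
  intro n d nc nz P μf μφ Lf Lφ ρ xf zφ x z w hA hf hμf hfc hxf hφ hμφ hφc hzφ hLφ hsm hLf hgrad
    hX hrank hρ hρ' hadmm hx0 hres hdual hQ
  have S : P.AdmmSetting μf μφ Lφ ρ xf zφ x z w :=
    ⟨hA, hf, hμf, hfc, hxf, hφ, hμφ, hφc, hzφ, hLφ, hsm, hX, hrank, hρ,
      (le_max_left _ _).trans hρ', hadmm, hx0, hres, hdual⟩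
  exact S.convergence (S.small_dual hLf
    (hgrad _ (right_mem_segment ℝ _ _) _ (left_mem_segment ℝ _ _)) hQ)
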